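/- Let $A\in\mathbb R^{n\times n}$, $B\in\mathbb R^{n\times m}$ with $(A,B)$ controllable, let $Q\in\mathbb R^{n\times n}$ and $R\in\mathbb R^{m\times m}$ be symmetric positive definite, and let $\Sigma_0\in\mathbb R^{n\times n}$ be symmetric positive definite (the second moment matrix $\mathbb E[\xi\xi^\top]$ of the initial state; $\Sigma_0=I$ is the normalized case). Let $\mathcal S_K$ be the set of stabilizing gains, i.e. of all $K\in\mathbb R^{m\times n}$ such that every eigenvalue of $A-BK$ has negative real part. Define $$f(K)=\operatorname{Tr}[P(K)\Sigma_0],\qquad P(K)=\int_0^\infty e^{(A-BK)^\top t}(Q+K^\top RK)e^{(A-BK)t}\,dt$$ for $K\in\mathcal S_K$, and $f(K)=\infty$ otherwise. Let $K^*=R^{-1}B^\top P^*$, where $P^*$ is the unique positive definite solution of $A^\top P+PA+Q-PBR^{-1}B^\top P=0$. For $K\in\mathcal S_K$, a matrix $G\in\mathbb R^{m\times n}$ is a $\theta$-robust estimate of the gradient $\nabla f(K)$ if $\|G-\nabla f(K)\|_F\le\theta\|\nabla f(K)\|_F$. For every real $a$ there are constants $\mu>\sigma_m>0$ and $b>0$,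 depending only on $A,B,Q,R$ and $a$ (and on $\Sigma_0$, if $\Sigma_0\ne I$), such that the following holds. Let $K_0\in\mathcal S_K$ with $f(K_0)=a$, let $0\le\theta<1/2$, $\sigma\in[0,\sigma_m]$ and $N\ge 0$, and let $K_{k+1}=K_k-\sigma G_k$ for $0\le k<N$, where $G_k$ is any $\theta$-robust estimate of $\nabla f(K_k)$. Then for all $0\le k\le N$ we have $K_k\in\mathcal S_K$, $$f(K_k)-f(K^*)\le(1-\sigma/\mu)^k\,\bigl(f(K_0)-f(K^*)\bigr),$$ $$\|K_k-K^*\|^2\le b\,(1-\sigma/\mu)^k\,\|K_0-K^*\|^2,$$ the last inequality both for the spectral norm and for the Frobenius norm. -/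

import Mathlib

open scoped Matrix

namespace LQR

noncomputable section

variable {n m : ℕ}

/-- Kalman's rank condition: the controllability matrix `[B, AB, …, A^(n-1) B]` has full rank `n`. -/
def IsControllable (A : Matrix (Fin n) (Fin n) ℝ) (B : Matrix (Fin n) (Fin m) ℝ) : Prop :=
  (Matrix.of fun (i : Fin n) (p : Fin n × Fin m) => (A ^ (p.1 : ℕ) * B) i p.2).rank = n

/-- Every (complex) eigenvalue has a strictly negative real part. -/
def IsHurwitz (M : Matrix (Fin n) (Fin n) ℝ) : Prop :=
  ∀ z ∈ spectrum ℂ (M.map (algebraMap ℝ ℂ)), z.re < 0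

/-- The set `S_K` of stabilizing feedback gains. -/
def stabilizing (A : Matrix (Fin n) (Fin n) ℝ) (B : Matrix (Fin n) (Fin m) ℝ) :
    Set (Matrix (Fin m) (Fin n) ℝ) :=
  {K | IsHurwitz (A - B * K)}

/-- `P(K) = ∫₀^∞ e^{(A-BK)ᵀ t} (Q + Kᵀ R K) e^{(A-BK) t} dt`, the matrix integral being taken
entry by entry. The integral converges for every stabilizing `K`. -/
def costMatrix (A : Matrix (Fin n) (Fin n) ℝ) (B : Matrix (Fin n) (Fin m) ℝ)
    (Q : Matrix (Fin n) (Fin n) ℝ) (R : Matrix (Fin m) (Fin m) ℝ)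
    (K : Matrix (Fin m) (Fin n) ℝ) : Matrix (Fin n) (Fin n) ℝ :=
  Matrix.of fun i j => ∫ t in Set.Ioi (0 : ℝ),
    (NormedSpace.exp (t • (A - B * K)ᵀ) * (Q + Kᵀ * R * K) *
      NormedSpace.exp (t • (A - B * K))) i j

open Classical in
/-- The LQR objective `f(K)`: it is `Tr[P(K) S]` for a stabilizing `K` and `∞` otherwise. Here `S`
is the second moment matrix `𝔼[ξ ξᵀ]` of the initial state `ξ`. -/
def cost (A : Matrix (Fin n) (Fin n) ℝ) (B : Matrix (Fin n) (Fin m) ℝ)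
    (Q : Matrix (Fin n) (Fin n) ℝ) (R : Matrix (Fin m) (Fin m) ℝ)
    (S : Matrix (Fin n) (Fin n) ℝ) (K : Matrix (Fin m) (Fin n) ℝ) : EReal :=
  if K ∈ stabilizing A B then (((costMatrix A B Q R K * S).trace : ℝ) : EReal) else ⊤

/-- `P` is a positive definite solution of the algebraic Riccati equation
`Aᵀ P + P A + Q - P B R⁻¹ Bᵀ P = 0`. -/
def IsRiccatiSolution (A : Matrix (Fin n) (Fin n) ℝ) (B : Matrix (Fin n) (Fin m) ℝ)
    (Q : Matrix (Fin n) (Fin n) ℝ) (R : Matrix (Fin m) (Fin m) ℝ)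
    (P : Matrix (Fin n) (Fin n) ℝ) : Prop :=
  P.PosDef ∧ Aᵀ * P + P * A + Q - P * B * R⁻¹ * Bᵀ * P = 0

open Classical in
/-- The positive definite solution `P*` of the algebraic Riccati equation. For a controllable pair
`(A, B)` and positive definite `Q`, `R` there is exactly one; the value `0` is a placeholder for
problem data without a solution. -/
def riccatiSolution (A : Matrix (Fin n) (Fin n) ℝ) (B : Matrix (Fin n) (Fin m) ℝ)
    (Q : Matrix (Fin n) (Fin n) ℝ) (R : Matrix (Fin m) (Fin m) ℝ) : Matrix (Fin n) (Fin n) ℝ :=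
  if h : ∃ P, IsRiccatiSolution A B Q R P then h.choose else 0

/-- The optimal feedback gain `K* = R⁻¹ Bᵀ P*`. -/
def optimalGain (A : Matrix (Fin n) (Fin n) ℝ) (B : Matrix (Fin n) (Fin m) ℝ)
    (Q : Matrix (Fin n) (Fin n) ℝ) (R : Matrix (Fin m) (Fin m) ℝ) : Matrix (Fin m) (Fin n) ℝ :=
  R⁻¹ * Bᵀ * riccatiSolution A B Q R

open scoped Matrix.Norms.Frobenius in
/-- The Frobenius norm `(∑ i j, |M i j|²)^(1/2)`. -/
def frobNorm (M : Matrix (Fin m) (Fin n) ℝ) : ℝ := ‖M‖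

/-- The spectral norm: the operator norm with respect to the Euclidean norms. -/
def specNorm (M : Matrix (Fin m) (Fin n) ℝ) : ℝ :=
  ‖LinearMap.toContinuousLinearMap (Matrix.toEuclideanLin M)‖

open scoped Matrix.Norms.Frobenius in
/-- The gradient of a function of a matrix with respect to the Frobenius inner product: the entry
at `(i, j)` is the value of the Fréchet derivative at the matrix unit `E_ij`. -/
def matrixGradient (F : Matrix (Fin m) (Fin n) ℝ → ℝ) (K : Matrix (Fin m) (Fin n) ℝ) :
    Matrix (Fin m) (Fin n) ℝ :=
  Matrix.of fun i j => fderiv ℝ F K (Matrix.single i j 1)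

/-- `∇ f(K)`. The objective is finite on the open set of stabilizing gains, so that passing to real
values does not change the gradient there. -/
def costGradient (A : Matrix (Fin n) (Fin n) ℝ) (B : Matrix (Fin n) (Fin m) ℝ)
    (Q : Matrix (Fin n) (Fin n) ℝ) (R : Matrix (Fin m) (Fin m) ℝ)
    (S : Matrix (Fin n) (Fin n) ℝ) (K : Matrix (Fin m) (Fin n) ℝ) : Matrix (Fin m) (Fin n) ℝ :=
  matrixGradient (fun L => (cost A B Q R S L).toReal) K

/-- `G` is a `θ`-robust estimate of `∇ f(K)`: `‖G - ∇ f(K)‖_F ≤ θ ‖∇ f(K)‖_F`. -/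
def IsRobustEstimate (A : Matrix (Fin n) (Fin n) ℝ) (B : Matrix (Fin n) (Fin m) ℝ)
    (Q : Matrix (Fin n) (Fin n) ℝ) (R : Matrix (Fin m) (Fin m) ℝ)
    (S : Matrix (Fin n) (Fin n) ℝ) (θ : ℝ) (K G : Matrix (Fin m) (Fin n) ℝ) : Prop :=
  frobNorm (G - costGradient A B Q R S K) ≤ θ * frobNorm (costGradient A B Q R S K)

/-- `K 0, …, K N` are the iterates of a run of policy gradient descent with step size `σ` and
`N` iterations: `K (k+1) = K k - σ G` for some `θ`-robust estimate `G` of `∇ f(K k)`. That the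
iterates stay stabilizing is not required. -/
def IsPolicyGradientRun (A : Matrix (Fin n) (Fin n) ℝ) (B : Matrix (Fin n) (Fin m) ℝ)
    (Q : Matrix (Fin n) (Fin n) ℝ) (R : Matrix (Fin m) (Fin m) ℝ)
    (S : Matrix (Fin n) (Fin n) ℝ) (θ σ : ℝ) (N : ℕ) (K : ℕ → Matrix (Fin m) (Fin n) ℝ) : Prop :=
  ∀ k < N, ∃ G, IsRobustEstimate A B Q R S θ (K k) G ∧ K (k + 1) = K k - σ • G

end

end LQR

/-!
The proof rests on exact formulas for the cost, obtained from Lyapunov equations alone.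

For a stabilizing gain `K`, the cost matrix `P(K)` solves the Lyapunov equation of `A - B K` with
inhomogeneity `Q + Kᵀ R K`, and the Gramian `Y(K)` (`stateGramian`) solves the adjoint equation with
inhomogeneity `S`. Both facts come from the exponential decay of `e^{(A - B K) t}`, which follows
from Gelfand's formula for `e^{A - B K}`. Solutions of a Lyapunov equation are unique and monotone in the
inhomogeneity (`IsHurwitz.posSemidef_of_lyapunov`), and a positive definite solution certifies
stability (`isHurwitz_of_lyapunov`). All estimates below are comparisons of this kind.

* With the residual `E = R K - Bᵀ P(K)`, the cost satisfies, exactly,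
  `f(K + D) - f(K) = 2 Tr(Dᵀ E Y(K + D)) + Tr(Dᵀ R D Y(K + D))` (`lqrValue_add_sub`).
* On a sublevel set, `K`, `E` and `Y(K)` are bounded and `Y(K)` is bounded below
  (`exists_sublevel_bounds`). As `Y(K)` is also a Lyapunov certificate for the gains near `K`, there
  is a uniform radius on which gains remain stabilizing and `Y` is Lipschitz
  (`exists_perturbation_bounds`). Hence `f` has a second-order model with uniform constants
  (`exists_quadratic_model`), and `∇f(K) = 2 E Y(K)` (`costGradient_eq`).
* A minimizer of the cost over a compact sublevel set has `E = 0`, which is the Riccati equation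
  (`exists_isRiccatiSolution`). So the optimal gain is stabilizing with `E = 0`, and the difference
  formula at the optimal gain makes `f(K) - f(K*)` comparable to `‖K - K*‖²`. Completing the square
  in the difference formula at `K` bounds `f(K) - f(K*)` by a multiple of `‖E‖²`
  (`lqrValue_sub_optimal_le`), hence of `‖∇f(K)‖²`.

An estimate `G` with relative error below `1 / 2` satisfies `⟨G, ∇f⟩ ≥ ‖∇f‖² / 2` and
`‖G‖ ≤ 3 ‖∇f‖ / 2`, so for small step sizes the second-order model gives a decrease of at least
`σ ‖∇f‖² / 4`, and gradient domination turns this into a contraction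
(`exists_contraction_constants`).
-/

namespace LQR

open Filter Topology Asymptotics MeasureTheory
open scoped Matrix.Norms.Frobenius

/-! ### Exponential decay of Hurwitz semigroups -/

/-- Half of the spectral mapping theorem for the matrix exponential: an eigenspace of `exp Z` is
invariant under `Z`, so it contains an eigenvector of `Z`. -/
theorem exists_exp_eq_of_mem_spectrum_exp {n : ℕ} (Z : Matrix (Fin n) (Fin n) ℂ) {z : ℂ}
    (hz : z ∈ spectrum ℂ (NormedSpace.exp Z)) :
    ∃ w ∈ spectrum ℂ Z, Complex.exp w = z := by
  rw [← Matrix.spectrum_toLin', ← Module.End.hasEigenvalue_iff_mem_spectrum] at hz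
  set f := Matrix.toLin' (NormedSpace.exp Z) with hf
  set g := Matrix.toLin' Z with hg
  have hcomm : Commute f g := by
    have h : Commute (NormedSpace.exp Z) Z := (Commute.refl Z).exp_left
    change f * g = g * f
    rw [hf, hg, Module.End.mul_eq_comp, Module.End.mul_eq_comp, ← Matrix.toLin'_mul,
      ← Matrix.toLin'_mul, h.eq]
  have hmaps : Set.MapsTo g (Module.End.eigenspace f z) (Module.End.eigenspace f z) :=
    Module.End.mapsTo_genEigenspace_of_comm hcomm z 1
  have : Nontrivial (Module.End.eigenspace f z) :=
    (Submodule.nontrivial_iff_ne_bot).2 hz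
  obtain ⟨w, hw⟩ := Module.End.exists_eigenvalue (g.restrict hmaps)
  obtain ⟨v, hv⟩ := hw.exists_hasEigenvector
  have hv0 : (v : Fin n → ℂ) ≠ 0 := fun h => hv.2 (Subtype.ext h)
  have hgv : g (v : Fin n → ℂ) = w • (v : Fin n → ℂ) :=
    congrArg Subtype.val (Module.End.mem_eigenspace_iff.1 hv.1)
  have hfv : f (v : Fin n → ℂ) = z • (v : Fin n → ℂ) := Module.End.mem_eigenspace_iff.1 v.2
  refine ⟨w, ?_, ?_⟩
  · rw [← Matrix.spectrum_toLin', ← Module.End.hasEigenvalue_iff_mem_spectrum]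
    exact Module.End.hasEigenvalue_of_hasEigenvector
      ⟨Module.End.mem_eigenspace_iff.2 hgv, hv0⟩
  -- The square matrix all of whose columns are the eigenvector intertwines `w • 1` and `Z`.
  · set V : Matrix (Fin n) (Fin n) ℂ := Matrix.of fun i _ => (v : Fin n → ℂ) i with hV
    have hmul : ∀ (X : Matrix (Fin n) (Fin n) ℂ) (i j : Fin n),
        (X * V) i j = (X *ᵥ (v : Fin n → ℂ)) i := fun X i j => rfl
    have hsemi : SemiconjBy V (algebraMap ℂ _ w) Z := by
      ext i j
      rw [hmul, ← Matrix.toLin'_apply, ← hg, hgv, ← Algebra.commutes, ← Algebra.smul_def]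
      rfl
    have hexp := hsemi.exp_right
    rw [← NormedSpace.algebraMap_exp_comm, ← Complex.exp_eq_exp_ℂ] at hexp
    obtain ⟨i, hi⟩ := Function.ne_iff.1 hv0
    have h := congrFun (congrFun hexp.eq i) i
    rw [← Algebra.commutes, ← Algebra.smul_def] at h
    exact mul_right_cancel₀ hi (h.trans (congrFun hfv i))

/-- The spectral radius of `exp Z` is less than one, so its powers decay geometrically by Gelfand's
formula; the remaining factor `exp ((t - ⌊t⌋) Z)` is bounded. -/
theorem isBigO_exp_smul_of_spectrum_re_neg {n : ℕ} (Z : Matrix (Fin n) (Fin n) ℂ)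
    (hZ : ∀ z ∈ spectrum ℂ Z, z.re < 0) :
    ∃ b : ℝ, 0 < b ∧ (fun t : ℝ => NormedSpace.exp (t • Z)) =O[atTop]
      fun t => Real.exp (-b * t) := by
  rcases Nat.eq_zero_or_pos n with rfl | hn
  · refine ⟨1, one_pos, IsBigO.of_bound 1 (Eventually.of_forall fun t => ?_)⟩
    rw [Subsingleton.elim (NormedSpace.exp (t • Z)) 0, norm_zero]
    positivity
  have : Nonempty (Fin n) := ⟨⟨0, hn⟩⟩
  have hrad : spectralRadius ℂ (NormedSpace.exp Z) < (1 : NNReal) := by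
    refine spectrum.spectralRadius_lt_of_forall_lt _ fun z hz => ?_
    obtain ⟨w, hw, rfl⟩ := exists_exp_eq_of_mem_spectrum_exp Z hz
    rw [← NNReal.coe_lt_coe, coe_nnnorm, Complex.norm_exp]
    simpa using hZ w hw
  obtain ⟨r, hr0, hr1⟩ := ENNReal.lt_iff_exists_nnreal_btwn.1 hrad
  have hr1' : (r : ℝ) < 1 := by exact_mod_cast hr1
  have hrpos : (0 : ℝ) < r := by
    have : (0 : ENNReal) < r := lt_of_le_of_lt bot_le hr0
    exact_mod_cast this
  have hgel := spectrum.pow_nnnorm_pow_one_div_tendsto_nhds_spectralRadius (NormedSpace.exp Z)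
  have hev : ∀ᶠ k : ℕ in atTop, ‖NormedSpace.exp Z ^ k‖ ≤ (r : ℝ) ^ k := by
    filter_upwards [hgel.eventually (gt_mem_nhds hr0), eventually_gt_atTop 0] with k hk hk0
    have h1 : (‖NormedSpace.exp Z ^ k‖₊ : ENNReal) ≤ (r : ENNReal) ^ (k : ℝ) := by
      rw [one_div] at hk
      exact ((ENNReal.rpow_inv_lt_iff (by exact_mod_cast hk0)).1 hk).le
    rw [ENNReal.rpow_natCast] at h1
    exact_mod_cast h1
  obtain ⟨C, hC⟩ := isCompact_Icc.exists_bound_of_continuousOn (s := Set.Icc (0 : ℝ) 1)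
    (f := fun t : ℝ => NormedSpace.exp (t • Z))
    ((NormedSpace.exp_continuous.comp (continuous_id.smul continuous_const)).continuousOn)
  refine ⟨-Real.log r, neg_pos.2 (Real.log_neg hrpos hr1'), IsBigO.of_bound (C * (r : ℝ)⁻¹) ?_⟩
  filter_upwards [tendsto_nat_floor_atTop.eventually hev, eventually_ge_atTop 0] with t ht ht0
  have hfl := Nat.floor_le ht0
  have hfl' := (Nat.lt_floor_add_one t).le
  have hsplit : NormedSpace.exp (t • Z) =
      NormedSpace.exp Z ^ ⌊t⌋₊ * NormedSpace.exp ((t - ⌊t⌋₊) • Z) := by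
    rw [← Matrix.exp_nsmul, ← Matrix.exp_add_of_commute, ← Nat.cast_smul_eq_nsmul ℝ,
      ← add_smul]
    · congr 2; ring
    · rw [← Nat.cast_smul_eq_nsmul ℝ]
      exact ((Commute.refl Z).smul_left _).smul_right _
  have hCt := hC (t - ⌊t⌋₊) ⟨by linarith, by linarith⟩
  have hC0 : 0 ≤ C := (norm_nonneg _).trans hCt
  have hpow : (r : ℝ) ^ ⌊t⌋₊ ≤ (r : ℝ)⁻¹ * Real.exp (-(-Real.log r) * t) := by
    rw [neg_neg, ← Real.rpow_def_of_pos hrpos, ← Real.rpow_natCast, ← Real.rpow_neg_one,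
      ← Real.rpow_add hrpos]
    exact Real.rpow_le_rpow_of_exponent_ge hrpos hr1'.le (by linarith)
  rw [hsplit, Real.norm_of_nonneg (Real.exp_pos _).le]
  calc _ ≤ ‖NormedSpace.exp Z ^ ⌊t⌋₊‖ * ‖NormedSpace.exp ((t - ⌊t⌋₊) • Z)‖ := norm_mul_le _ _
    _ ≤ ((r : ℝ)⁻¹ * Real.exp (-(-Real.log r) * t)) * C := by
        gcongr
        exact ht.trans hpow
    _ = _ := by ring

theorem IsHurwitz.isBigO_exp_smul {n : ℕ} {M : Matrix (Fin n) (Fin n) ℝ} (hM : IsHurwitz M) :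
    ∃ b : ℝ, 0 < b ∧ (fun t : ℝ => NormedSpace.exp (t • M)) =O[atTop]
      fun t => Real.exp (-b * t) := by
  obtain ⟨b, hb, h⟩ := isBigO_exp_smul_of_spectrum_re_neg _ hM
  refine ⟨b, hb, (IsBigO.of_norm_left ?_)⟩
  refine h.norm_left.congr_left fun t => ?_
  have hmap : NormedSpace.exp (t • M.map (algebraMap ℝ ℂ)) =
      (NormedSpace.exp (t • M)).map (algebraMap ℝ ℂ) := by
    have hc : Continuous ((algebraMap ℝ ℂ).mapMatrix : Matrix (Fin n) (Fin n) ℝ →+* _) :=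
      continuous_id.matrix_map (continuous_algebraMap ℝ ℂ)
    have := NormedSpace.map_exp ((algebraMap ℝ ℂ).mapMatrix : Matrix (Fin n) (Fin n) ℝ →+* _) hc
      (t • M)
    refine Eq.trans (congrArg _ ?_) this.symm
    ext i j
    simp
  rw [hmap]
  exact Matrix.frobenius_norm_map_eq _ _ fun a => by simp

theorem IsHurwitz.transpose {n : ℕ} {M : Matrix (Fin n) (Fin n) ℝ} (hM : IsHurwitz M) :
    IsHurwitz Mᵀ := by
  intro z hz
  apply hM
  rwa [Matrix.mem_spectrum_iff_isRoot_charpoly, ← Matrix.charpoly_transpose, ← Matrix.transpose_map,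
    ← Matrix.mem_spectrum_iff_isRoot_charpoly]

/-! ### The Lyapunov equation -/

variable {n : ℕ}

/-- The entrywise integral `∫₀^∞ e^{Mᵀ t} W e^{M t} dt`, which for a Hurwitz matrix `M` is the
solution of the Lyapunov equation `Mᵀ X + X M + W = 0`. -/
noncomputable def lyapunovIntegral (M W : Matrix (Fin n) (Fin n) ℝ) : Matrix (Fin n) (Fin n) ℝ :=
  Matrix.of fun i j => ∫ t in Set.Ioi (0 : ℝ),
    (NormedSpace.exp (t • Mᵀ) * W * NormedSpace.exp (t • M)) i j

/-- The `(i, j)` entry as a continuous linear functional. -/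
noncomputable def entryCLM {m n : ℕ} (i : Fin m) (j : Fin n) : Matrix (Fin m) (Fin n) ℝ →L[ℝ] ℝ :=
  LinearMap.toContinuousLinearMap (Matrix.entryLinearMap ℝ ℝ i j)

theorem hasDerivAt_lyapunovIntegrand (M W : Matrix (Fin n) (Fin n) ℝ) (i j : Fin n) (t : ℝ) :
    HasDerivAt (fun t : ℝ => (NormedSpace.exp (t • Mᵀ) * W * NormedSpace.exp (t • M)) i j)
      ((Mᵀ * (NormedSpace.exp (t • Mᵀ) * W * NormedSpace.exp (t • M)) +
        (NormedSpace.exp (t • Mᵀ) * W * NormedSpace.exp (t • M)) * M) i j) t := by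
  have h := ((hasDerivAt_exp_smul_const' Mᵀ t).mul_const W).mul (hasDerivAt_exp_smul_const M t)
  exact (entryCLM i j).hasFDerivAt.comp_hasDerivAt t (h.congr_deriv
    (show _ = Mᵀ * (NormedSpace.exp (t • Mᵀ) * W * NormedSpace.exp (t • M)) +
        (NormedSpace.exp (t • Mᵀ) * W * NormedSpace.exp (t • M)) * M by
      simp only [Matrix.mul_assoc]
      rfl))

theorem IsHurwitz.isBigO_lyapunovIntegrand {M : Matrix (Fin n) (Fin n) ℝ} (hM : IsHurwitz M)
    (W : Matrix (Fin n) (Fin n) ℝ) : ∃ b : ℝ, 0 < b ∧ ∀ i j,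
      (fun t : ℝ => (NormedSpace.exp (t • Mᵀ) * W * NormedSpace.exp (t • M)) i j) =O[atTop]
        fun t => Real.exp (-b * t) := by
  obtain ⟨b, hb, h⟩ := hM.isBigO_exp_smul
  obtain ⟨c, hc, h'⟩ := hM.transpose.isBigO_exp_smul
  refine ⟨c + b, by positivity, fun i j => ?_⟩
  have hW : (fun _ : ℝ => W) =O[atTop] fun _ => (1 : ℝ) := isBigO_const_const _ one_ne_zero _
  have hprod := (h'.mul hW).mul h
  refine (((entryCLM i j).isBigO_comp _ _).trans hprod).congr_right fun t => ?_
  rw [mul_one, ← Real.exp_add]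
  congr 1
  ring

theorem IsHurwitz.integrableOn_lyapunovIntegrand {M : Matrix (Fin n) (Fin n) ℝ} (hM : IsHurwitz M)
    (W : Matrix (Fin n) (Fin n) ℝ) (i j : Fin n) :
    IntegrableOn (fun t : ℝ => (NormedSpace.exp (t • Mᵀ) * W * NormedSpace.exp (t • M)) i j)
      (Set.Ioi 0) := by
  obtain ⟨b, hb, h⟩ := hM.isBigO_lyapunovIntegrand W
  exact integrable_of_isBigO_exp_neg hb
    (fun t _ => (hasDerivAt_lyapunovIntegrand M W i j t).continuousAt.continuousWithinAt) (h i j)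

theorem IsHurwitz.lyapunovIntegral_eq {M : Matrix (Fin n) (Fin n) ℝ} (hM : IsHurwitz M)
    (W : Matrix (Fin n) (Fin n) ℝ) :
    Mᵀ * lyapunovIntegral M W + lyapunovIntegral M W * M + W = 0 := by
  ext i j
  have hint := hM.integrableOn_lyapunovIntegrand W
  set φ : ℝ → Matrix (Fin n) (Fin n) ℝ :=
    fun t => NormedSpace.exp (t • Mᵀ) * W * NormedSpace.exp (t • M) with hφ
  have hderiv : ∀ t : ℝ, HasDerivAt (fun t => φ t i j) ((Mᵀ * φ t + φ t * M) i j) t :=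
    hasDerivAt_lyapunovIntegrand M W i j
  have hint1 : ∀ k ∈ Finset.univ, IntegrableOn (fun t => Mᵀ i k * φ t k j) (Set.Ioi 0) :=
    fun k _ => (hint k j).const_mul _
  have hint2 : ∀ k ∈ Finset.univ, IntegrableOn (fun t => φ t i k * M k j) (Set.Ioi 0) :=
    fun k _ => (hint i k).mul_const _
  have hlim : Tendsto (fun t => φ t i j) atTop (𝓝 0) := by
    obtain ⟨b, hb, h⟩ := hM.isBigO_lyapunovIntegrand W
    refine (h i j).trans_tendsto ?_
    have : Tendsto (fun t : ℝ => -b * t) atTop atBot :=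
      tendsto_id.const_mul_atTop_of_neg (neg_lt_zero.2 hb)
    exact Real.tendsto_exp_atBot.comp this
  have hftc := integral_Ioi_of_hasDerivAt_of_tendsto' (a := 0) (fun t _ => hderiv t)
    (by
      simp only [Matrix.add_apply, Matrix.mul_apply]
      exact (integrable_finsetSum _ hint1).add (integrable_finsetSum _ hint2)) hlim
  simp only [Matrix.add_apply, Matrix.mul_apply] at hftc
  rw [integral_add (integrable_finsetSum _ hint1) (integrable_finsetSum _ hint2),
    integral_finsetSum _ hint1, integral_finsetSum _ hint2] at hftc
  simp only [integral_const_mul, integral_mul_const] at hftc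
  have hφ0 : φ 0 i j = W i j := by
    simp [hφ]
  rw [hφ0] at hftc
  have hentry : ∀ k l, lyapunovIntegral M W k l = ∫ t in Set.Ioi (0 : ℝ), φ t k l :=
    fun _ _ => rfl
  simp only [Matrix.add_apply, Matrix.mul_apply, Matrix.zero_apply, hentry]
  linarith

theorem IsHurwitz.posSemidef_lyapunovIntegral {M W : Matrix (Fin n) (Fin n) ℝ} (hM : IsHurwitz M)
    (hW : W.PosSemidef) : (lyapunovIntegral M W).PosSemidef := by
  have hint := hM.integrableOn_lyapunovIntegrand W
  have hφ : ∀ t : ℝ,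
      (NormedSpace.exp (t • Mᵀ) * W * NormedSpace.exp (t • M)).PosSemidef := fun t => by
    have h := hW.conjTranspose_mul_mul_same (NormedSpace.exp (t • M))
    rwa [Matrix.conjTranspose_eq_transpose_of_trivial, ← Matrix.exp_transpose,
      Matrix.transpose_smul] at h
  refine Matrix.PosSemidef.of_dotProduct_mulVec_nonneg ?_ fun x => ?_
  · ext i j
    simp only [Matrix.conjTranspose_apply, lyapunovIntegral, Matrix.of_apply, star_trivial]
    refine integral_congr_ae (Eventually.of_forall fun t => ?_)
    simpa using (hφ t).isHermitian.apply i j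
  · have hsum : star x ⬝ᵥ lyapunovIntegral M W *ᵥ x = ∫ t in Set.Ioi (0 : ℝ),
        star x ⬝ᵥ (NormedSpace.exp (t • Mᵀ) * W * NormedSpace.exp (t • M)) *ᵥ x := by
      simp only [dotProduct, Matrix.mulVec, lyapunovIntegral, Matrix.of_apply]
      rw [integral_finsetSum _ fun i _ => ((integrable_finsetSum _
        fun j _ => (hint i j).mul_const (x j)).const_mul _)]
      refine Finset.sum_congr rfl fun i _ => ?_
      rw [integral_const_mul, integral_finsetSum _ fun j _ => (hint i j).mul_const (x j)]
      simp only [integral_mul_const]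
    rw [hsum]
    exact integral_nonneg fun t => (hφ t).dotProduct_mulVec_nonneg x

/-- Duality between a Lyapunov equation and its adjoint. -/
theorem trace_mul_eq_of_lyapunov {M X W Y V : Matrix (Fin n) (Fin n) ℝ}
    (hX : Mᵀ * X + X * M + W = 0) (hY : M * Y + Y * Mᵀ + V = 0) :
    (X * V).trace = (W * Y).trace := by
  have h1 : W = -(Mᵀ * X + X * M) := eq_neg_of_add_eq_zero_right hX
  have h2 : V = -(M * Y + Y * Mᵀ) := eq_neg_of_add_eq_zero_right hY
  rw [h1, h2]
  simp only [Matrix.mul_neg, Matrix.neg_mul, Matrix.trace_neg, Matrix.mul_add, Matrix.add_mul,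
    Matrix.trace_add]
  rw [Matrix.mul_assoc Mᵀ X Y, Matrix.trace_mul_comm Mᵀ, Matrix.mul_assoc X M Y,
    Matrix.mul_assoc X Y]
  ring

/-- By duality, the difference of two solutions is orthogonal to every inhomogeneity of the adjoint
equation, in particular to itself. -/
theorem IsHurwitz.lyapunov_unique {M W X X' : Matrix (Fin n) (Fin n) ℝ} (hM : IsHurwitz M)
    (hX : Mᵀ * X + X * M + W = 0) (hX' : Mᵀ * X' + X' * M + W = 0) : X = X' := by
  have hY := hM.transpose.lyapunovIntegral_eq (X - X')ᵀ
  rw [Matrix.transpose_transpose] at hY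
  have h1 := trace_mul_eq_of_lyapunov hX hY
  have h2 := trace_mul_eq_of_lyapunov hX' hY
  have h : ((X - X') * (X - X')ᴴ).trace = 0 := by
    rw [Matrix.conjTranspose_eq_transpose_of_trivial, Matrix.sub_mul, Matrix.trace_sub, h1, h2,
      sub_self]
  exact sub_eq_zero.1 (Matrix.trace_mul_conjTranspose_self_eq_zero_iff.1 h)

theorem IsHurwitz.posSemidef_of_lyapunov {M W X : Matrix (Fin n) (Fin n) ℝ} (hM : IsHurwitz M)
    (hX : Mᵀ * X + X * M + W = 0) (hW : W.PosSemidef) : X.PosSemidef := by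
  rw [hM.lyapunov_unique hX (hM.lyapunovIntegral_eq W)]
  exact hM.posSemidef_lyapunovIntegral hW

/-- Lyapunov's stability criterion. For an eigenvector `x + i y` of `M` with eigenvalue `z`, the
quadratic form of `Mᵀ X + X M` summed over `x` and `y` is `2 Re z (xᵀ X x + yᵀ X y)`. -/
theorem isHurwitz_of_lyapunov {M W X : Matrix (Fin n) (Fin n) ℝ}
    (hX : X.PosDef) (hW : W.PosDef) (h : Mᵀ * X + X * M + W = 0) : IsHurwitz M := by
  intro z hz
  rw [← Matrix.spectrum_toLin', ← Module.End.hasEigenvalue_iff_mem_spectrum] at hz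
  obtain ⟨u, hu⟩ := hz.exists_hasEigenvector
  have hu1 := Module.End.mem_eigenspace_iff.1 hu.1
  rw [Matrix.toLin'_apply] at hu1
  set x : Fin n → ℝ := fun i => (u i).re with hx
  set y : Fin n → ℝ := fun i => (u i).im with hy
  have hMx : M *ᵥ x = z.re • x - z.im • y := by
    ext i
    have := congrArg Complex.re (congrFun hu1 i)
    simpa [Matrix.mulVec, dotProduct, hx, hy] using this
  have hMy : M *ᵥ y = z.im • x + z.re • y := by
    ext i
    have := congrArg Complex.im (congrFun hu1 i)
    simp [Matrix.mulVec, dotProduct, hx, hy] at this ⊢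
    linarith
  have hXT : Xᵀ = X := by
    simpa [Matrix.IsHermitian] using hX.isHermitian
  have hsymm : ∀ v w : Fin n → ℝ, v ⬝ᵥ X *ᵥ w = w ⬝ᵥ X *ᵥ v := fun v w => by
    rw [Matrix.dotProduct_mulVec, ← Matrix.mulVec_transpose, hXT, dotProduct_comm]
  have hquad : ∀ v : Fin n → ℝ, v ⬝ᵥ W *ᵥ v = -2 * (v ⬝ᵥ X *ᵥ (M *ᵥ v)) := fun v => by
    have h1 : W = -(Mᵀ * X + X * M) := eq_neg_of_add_eq_zero_right h
    rw [h1, Matrix.neg_mulVec, Matrix.add_mulVec, ← Matrix.mulVec_mulVec, ← Matrix.mulVec_mulVec,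
      dotProduct_neg, dotProduct_add, Matrix.dotProduct_mulVec v Mᵀ, Matrix.vecMul_transpose,
      hsymm (M *ᵥ v) v]
    ring
  have hsum : x ⬝ᵥ W *ᵥ x + y ⬝ᵥ W *ᵥ y = -2 * z.re * (x ⬝ᵥ X *ᵥ x + y ⬝ᵥ X *ᵥ y) := by
    rw [hquad, hquad, hMx, hMy, Matrix.mulVec_sub, Matrix.mulVec_add]
    simp only [Matrix.mulVec_smul, dotProduct_sub, dotProduct_add, dotProduct_smul, smul_eq_mul]
    rw [hsymm y x]
    ring
  have hxy : x ≠ 0 ∨ y ≠ 0 := by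
    by_contra! hcon
    refine hu.2 (funext fun i => Complex.ext ?_ ?_)
    · exact congrFun hcon.1 i
    · exact congrFun hcon.2 i
  have hpos : ∀ {V : Matrix (Fin n) (Fin n) ℝ}, V.PosDef →
      0 < x ⬝ᵥ V *ᵥ x + y ⬝ᵥ V *ᵥ y := fun {V} hV => by
    rcases hxy with hx0 | hy0
    · exact add_pos_of_pos_of_nonneg (by simpa using hV.dotProduct_mulVec_pos hx0)
        (by simpa using hV.posSemidef.dotProduct_mulVec_nonneg y)
    · exact add_pos_of_nonneg_of_pos (by simpa using hV.posSemidef.dotProduct_mulVec_nonneg x)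
        (by simpa using hV.dotProduct_mulVec_pos hy0)
  have h1 := hpos hW
  have h2 := hpos hX
  rw [hsum] at h1
  nlinarith

/-! ### Frobenius norm, trace and positive semidefiniteness -/

theorem trace_transpose_mul_eq_sum {m n : ℕ} (M N : Matrix (Fin m) (Fin n) ℝ) :
    (Mᵀ * N).trace = ∑ p : Fin m × Fin n, M p.1 p.2 * N p.1 p.2 := by
  rw [Fintype.sum_prod_type_right]
  rfl

theorem norm_sq_eq_trace {m n : ℕ} (M : Matrix (Fin m) (Fin n) ℝ) :
    ‖M‖ ^ 2 = (Mᵀ * M).trace := by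
  rw [Matrix.frobenius_norm_def, ← Real.sqrt_eq_rpow, Real.sq_sqrt (by positivity),
    trace_transpose_mul_eq_sum, Fintype.sum_prod_type]
  simp [sq]

/-- The Cauchy–Schwarz inequality for the Frobenius inner product. -/
theorem abs_trace_transpose_mul_le {m n : ℕ} (M N : Matrix (Fin m) (Fin n) ℝ) :
    |(Mᵀ * N).trace| ≤ ‖M‖ * ‖N‖ := by
  refine abs_le_of_sq_le_sq ?_ (by positivity)
  rw [mul_pow, norm_sq_eq_trace, norm_sq_eq_trace]
  simp only [trace_transpose_mul_eq_sum]
  simpa [sq] using Finset.sum_mul_sq_le_sq_mul_sq Finset.univ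
    (fun p : Fin m × Fin n => M p.1 p.2) (fun p => N p.1 p.2)

theorem trace_transpose_mul_le {m n : ℕ} (M N : Matrix (Fin m) (Fin n) ℝ) :
    (Mᵀ * N).trace ≤ ‖M‖ * ‖N‖ :=
  (le_abs_self _).trans (abs_trace_transpose_mul_le M N)

theorem transpose_eq_of_posSemidef {X : Matrix (Fin n) (Fin n) ℝ} (hX : X.PosSemidef) :
    Xᵀ = X := by
  simpa [Matrix.IsHermitian] using hX.isHermitian

theorem trace_transpose_mul_mul_comm {m : ℕ} {Y : Matrix (Fin n) (Fin n) ℝ} (hY : Yᵀ = Y)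
    (M N : Matrix (Fin m) (Fin n) ℝ) : (Mᵀ * N * Y).trace = (Nᵀ * M * Y).trace := by
  rw [← Matrix.trace_transpose, Matrix.transpose_mul, Matrix.transpose_mul, hY,
    Matrix.transpose_transpose, Matrix.trace_mul_comm]

theorem exists_eq_transpose_mul_self {X : Matrix (Fin n) (Fin n) ℝ} (hX : X.PosSemidef) :
    ∃ C : Matrix (Fin n) (Fin n) ℝ, X = Cᵀ * C := by
  open scoped MatrixOrder in
  obtain ⟨C, hC⟩ := CStarAlgebra.nonneg_iff_eq_star_mul_self.1 (Matrix.nonneg_iff_posSemidef.2 hX)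
  exact ⟨C, by simpa [Matrix.star_eq_conjTranspose] using hC⟩

theorem trace_mul_nonneg {X Y : Matrix (Fin n) (Fin n) ℝ} (hX : X.PosSemidef)
    (hY : Y.PosSemidef) : 0 ≤ (X * Y).trace := by
  obtain ⟨C, rfl⟩ := exists_eq_transpose_mul_self hX
  rw [Matrix.mul_assoc, Matrix.trace_mul_comm]
  simpa using (hY.mul_mul_conjTranspose_same C).trace_nonneg

theorem norm_le_trace {X : Matrix (Fin n) (Fin n) ℝ} (hX : X.PosSemidef) : ‖X‖ ≤ X.trace := by
  obtain ⟨C, rfl⟩ := exists_eq_transpose_mul_self hX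
  rw [← norm_sq_eq_trace, sq]
  exact (Matrix.frobenius_norm_mul _ _).trans_eq (by rw [Matrix.frobenius_norm_transpose])

theorem posSemidef_smul_one_sub {H : Matrix (Fin n) (Fin n) ℝ} (hH : Hᵀ = H) {c : ℝ}
    (hc : ‖H‖ ≤ c) : (c • (1 : Matrix (Fin n) (Fin n) ℝ) - H).PosSemidef := by
  refine Matrix.PosSemidef.of_dotProduct_mulVec_nonneg ?_ fun x => ?_
  · simp [Matrix.IsHermitian, hH]
  have hnorm : ‖Matrix.vecMulVec x x‖ = x ⬝ᵥ x := by
    have hx : 0 ≤ x ⬝ᵥ x := by simpa using dotProduct_star_self_nonneg x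
    rw [← sq_eq_sq₀ (norm_nonneg _) hx, norm_sq_eq_trace, Matrix.transpose_vecMulVec,
      Matrix.vecMulVec_mul_vecMulVec, Matrix.trace_vecMulVec, dotProduct_smul, smul_eq_mul, sq]
  have htrace : ((Matrix.vecMulVec x x)ᵀ * H).trace = x ⬝ᵥ H *ᵥ x := by
    rw [Matrix.transpose_vecMulVec, Matrix.vecMulVec_mul, Matrix.trace_vecMulVec,
      Matrix.dotProduct_mulVec, dotProduct_comm]
  have hle := trace_transpose_mul_le (Matrix.vecMulVec x x) H
  rw [hnorm, htrace] at hle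
  have hx : 0 ≤ x ⬝ᵥ x := by simpa using dotProduct_star_self_nonneg x
  rw [star_trivial, Matrix.sub_mulVec, Matrix.smul_mulVec, Matrix.one_mulVec, dotProduct_sub,
    dotProduct_smul, smul_eq_mul]
  nlinarith

theorem posSemidef_smul_one_add {H : Matrix (Fin n) (Fin n) ℝ} (hH : Hᵀ = H) {c : ℝ}
    (hc : ‖H‖ ≤ c) : (c • (1 : Matrix (Fin n) (Fin n) ℝ) + H).PosSemidef := by
  have := posSemidef_smul_one_sub (H := -H) (c := c) (by rw [Matrix.transpose_neg, hH])
    (by rwa [norm_neg])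
  rwa [sub_neg_eq_add] at this

/-- A positive definite matrix dominates a positive multiple of the identity. With `X = Cᵀ C`, the
claim is conjugate to the domination of `c (C⁻¹)ᵀ C⁻¹` by the identity, for small `c`. -/
theorem exists_pos_posSemidef_sub {X : Matrix (Fin n) (Fin n) ℝ} (hX : X.PosDef) :
    ∃ c : ℝ, 0 < c ∧ (X - c • (1 : Matrix (Fin n) (Fin n) ℝ)).PosSemidef := by
  obtain ⟨C, rfl⟩ := exists_eq_transpose_mul_self hX.posSemidef
  have hC : IsUnit C.det := by
    have h := (Matrix.isUnit_iff_isUnit_det _).1 hX.isUnit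
    rw [Matrix.det_mul] at h
    exact isUnit_of_mul_isUnit_right h
  set H : Matrix (Fin n) (Fin n) ℝ := (C⁻¹)ᵀ * C⁻¹ with hHdef
  have hH : Hᵀ = H := by simp [hHdef, Matrix.transpose_mul]
  set c : ℝ := (‖H‖ + 1)⁻¹ with hc
  have hc0 : 0 < c := by positivity
  refine ⟨c, hc0, ?_⟩
  have hle : ‖c • H‖ ≤ 1 := by
    rw [norm_smul, Real.norm_of_nonneg hc0.le, hc, inv_mul_le_one₀ (by positivity)]
    linarith
  have h := (posSemidef_smul_one_sub (by rw [Matrix.transpose_smul, hH])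
    hle).conjTranspose_mul_mul_same C
  rw [Matrix.conjTranspose_eq_transpose_of_trivial, one_smul, Matrix.mul_sub, Matrix.sub_mul,
    Matrix.mul_one] at h
  convert h using 2
  rw [Matrix.mul_smul, Matrix.smul_mul, hHdef, ← Matrix.mul_assoc, Matrix.mul_assoc,
    Matrix.nonsing_inv_mul _ hC, Matrix.mul_one, ← Matrix.transpose_mul, Matrix.nonsing_inv_mul _ hC, Matrix.transpose_one]

theorem posDef_of_posSemidef_sub {X : Matrix (Fin n) (Fin n) ℝ} {c : ℝ} (hc : 0 < c)
    (hX : (X - c • (1 : Matrix (Fin n) (Fin n) ℝ)).PosSemidef) : X.PosDef := by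
  have := (Matrix.PosDef.one.smul hc).add_posSemidef hX
  rwa [add_sub_cancel] at this

theorem mul_trace_le_trace_mul {X Y : Matrix (Fin n) (Fin n) ℝ} {c : ℝ}
    (hX : (X - c • (1 : Matrix (Fin n) (Fin n) ℝ)).PosSemidef) (hY : Y.PosSemidef) :
    c * Y.trace ≤ (X * Y).trace := by
  have h := trace_mul_nonneg hX hY
  rw [Matrix.sub_mul, Matrix.trace_sub, Matrix.smul_mul, Matrix.one_mul, Matrix.trace_smul,
    smul_eq_mul] at h
  linarith

theorem mul_norm_sq_le_trace {m : ℕ} {X : Matrix (Fin n) (Fin n) ℝ} {c : ℝ}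
    (hX : (X - c • (1 : Matrix (Fin n) (Fin n) ℝ)).PosSemidef) (N : Matrix (Fin m) (Fin n) ℝ) :
    c * ‖N‖ ^ 2 ≤ (Nᵀ * N * X).trace := by
  have h := mul_trace_le_trace_mul hX (Y := Nᵀ * N)
    (by simpa using Matrix.posSemidef_conjTranspose_mul_self N)
  rwa [← norm_sq_eq_trace, Matrix.trace_mul_comm] at h

theorem norm_le_of_sandwich {X Z : Matrix (Fin n) (Fin n) ℝ} (hX : X.PosSemidef)
    (h1 : (X - Z).PosSemidef) (h2 : (X + Z).PosSemidef) : ‖Z‖ ≤ 3 * X.trace := by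
  have h3 : ‖Z‖ ≤ ‖X - Z‖ + ‖X‖ := by
    rw [norm_sub_rev]
    simpa using norm_add_le (Z - X) X
  have h4 := norm_le_trace h1
  have h5 := h2.trace_nonneg
  have h6 := norm_le_trace hX
  rw [Matrix.trace_sub] at h4
  rw [Matrix.trace_add] at h5
  linarith

/-! ### Comparison of the spectral and the Frobenius norm -/

theorem specNorm_le_frobNorm {m : ℕ} (M : Matrix (Fin m) (Fin n) ℝ) :
    specNorm M ≤ frobNorm M := by
  refine ContinuousLinearMap.opNorm_le_bound _ (norm_nonneg _) fun x => ?_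
  have h := Matrix.frobenius_norm_mul M (Matrix.replicateCol (Fin 1) x.ofLp)
  have hcol : ∀ {k : ℕ} (v : Fin k → ℝ),
      ‖Matrix.replicateCol (Fin 1) v‖ = ‖WithLp.toLp 2 v‖ :=
    fun v => Matrix.frobenius_norm_replicateCol v
  rw [← Matrix.replicateCol_mulVec, hcol, hcol] at h
  exact h

theorem frobNorm_sq_le_specNorm_sq {m : ℕ} (M : Matrix (Fin m) (Fin n) ℝ) :
    frobNorm M ^ 2 ≤ n * specNorm M ^ 2 := by
  have hcol : ∀ j : Fin n, ∑ i, M i j ^ 2 ≤ specNorm M ^ 2 := fun j => by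
    have h := (LinearMap.toContinuousLinearMap (Matrix.toEuclideanLin M)).le_opNorm
      (EuclideanSpace.single j 1)
    rw [PiLp.norm_single, norm_one, mul_one] at h
    have h2 := pow_le_pow_left₀ (norm_nonneg _) h 2
    rw [EuclideanSpace.norm_sq_eq] at h2
    refine le_trans (le_of_eq (Finset.sum_congr rfl fun i _ => ?_)) h2
    simp
  calc frobNorm M ^ 2 = ∑ j, ∑ i, M i j ^ 2 := by
        rw [frobNorm, norm_sq_eq_trace, trace_transpose_mul_eq_sum, Fintype.sum_prod_type_right]
        simp [sq]
    _ ≤ ∑ _j : Fin n, specNorm M ^ 2 := Finset.sum_le_sum fun j _ => hcol j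
    _ = _ := by simp

/-! ### A lower bound for solutions of the Lyapunov equation -/

/-- A solution of the Lyapunov equation dominates a multiple of the identity that depends on `M`
only through its norm: `X - c` solves the equation with inhomogeneity `W + c (Mᵀ + M)`, which is positive
semidefinite as long as `2 c ‖M‖ ≤ s`. -/
theorem IsHurwitz.posSemidef_sub_of_lyapunov {M W X : Matrix (Fin n) (Fin n) ℝ}
    (hM : IsHurwitz M) (hX : Mᵀ * X + X * M + W = 0) {s : ℝ} (hs : 0 < s)
    (hW : (W - s • (1 : Matrix (Fin n) (Fin n) ℝ)).PosSemidef) :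
    (X - (s / (2 * ‖M‖ + 1)) • (1 : Matrix (Fin n) (Fin n) ℝ)).PosSemidef := by
  set c : ℝ := s / (2 * ‖M‖ + 1) with hc
  have hc0 : 0 < c := by positivity
  refine hM.posSemidef_of_lyapunov (W := W + c • (Mᵀ + M)) ?_ ?_
  · rw [← hX]
    simp only [Matrix.mul_sub, Matrix.sub_mul, Matrix.mul_smul, Matrix.smul_mul, Matrix.mul_one,
      Matrix.one_mul, smul_add]
    abel
  · have hle : ‖c • (Mᵀ + M)‖ ≤ s := by
      have h1 : ‖Mᵀ + M‖ ≤ 2 * ‖M‖ := by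
        refine (norm_add_le _ _).trans ?_
        rw [Matrix.frobenius_norm_transpose]
        linarith
      rw [norm_smul, Real.norm_of_nonneg hc0.le]
      calc c * ‖Mᵀ + M‖ ≤ c * (2 * ‖M‖ + 1) := by gcongr; linarith
        _ = s := by rw [hc]; field_simp
    have h := hW.add (posSemidef_smul_one_add (H := c • (Mᵀ + M)) (c := s)
      (by simp [add_comm]) hle)
    convert h using 1
    abel

/-! ### The cost of a stabilizing gain -/

variable {m : ℕ}

/-- The real value of the LQR objective at a stabilizing gain. -/
noncomputable def lqrValue (A : Matrix (Fin n) (Fin n) ℝ) (B : Matrix (Fin n) (Fin m) ℝ)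
    (Q : Matrix (Fin n) (Fin n) ℝ) (R : Matrix (Fin m) (Fin m) ℝ)
    (S : Matrix (Fin n) (Fin n) ℝ) (K : Matrix (Fin m) (Fin n) ℝ) : ℝ :=
  (costMatrix A B Q R K * S).trace

/-- The accumulated state covariance `Y(K) = ∫₀^∞ e^{(A-BK) t} S e^{(A-BK)ᵀ t} dt`. -/
noncomputable def stateGramian (A : Matrix (Fin n) (Fin n) ℝ) (B : Matrix (Fin n) (Fin m) ℝ)
    (S : Matrix (Fin n) (Fin n) ℝ) (K : Matrix (Fin m) (Fin n) ℝ) : Matrix (Fin n) (Fin n) ℝ :=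
  lyapunovIntegral (A - B * K)ᵀ S

/-- The residual `E(K) = R K - Bᵀ P(K)`, in terms of which the gradient of the cost is
`2 E(K) Y(K)`. -/
noncomputable def gainResidual (A : Matrix (Fin n) (Fin n) ℝ) (B : Matrix (Fin n) (Fin m) ℝ)
    (Q : Matrix (Fin n) (Fin n) ℝ) (R : Matrix (Fin m) (Fin m) ℝ)
    (K : Matrix (Fin m) (Fin n) ℝ) : Matrix (Fin m) (Fin n) ℝ :=
  R * K - Bᵀ * costMatrix A B Q R K

variable {A : Matrix (Fin n) (Fin n) ℝ} {B : Matrix (Fin n) (Fin m) ℝ}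
  {Q : Matrix (Fin n) (Fin n) ℝ} {R : Matrix (Fin m) (Fin m) ℝ}
  {S : Matrix (Fin n) (Fin n) ℝ} {K D : Matrix (Fin m) (Fin n) ℝ}

theorem posDef_stageCost (hQ : Q.PosDef) (hR : R.PosDef) (K : Matrix (Fin m) (Fin n) ℝ) :
    (Q + Kᵀ * R * K).PosDef :=
  hQ.add_posSemidef (by simpa using hR.posSemidef.conjTranspose_mul_mul_same K)

theorem costMatrix_lyapunov (hK : K ∈ stabilizing A B) :
    (A - B * K)ᵀ * costMatrix A B Q R K + costMatrix A B Q R K * (A - B * K) +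
      (Q + Kᵀ * R * K) = 0 :=
  IsHurwitz.lyapunovIntegral_eq hK (Q + Kᵀ * R * K)

theorem posDef_costMatrix (hQ : Q.PosDef) (hR : R.PosDef) (hK : K ∈ stabilizing A B) :
    (costMatrix A B Q R K).PosDef := by
  obtain ⟨c, hc, h⟩ := exists_pos_posSemidef_sub (posDef_stageCost hQ hR K)
  exact posDef_of_posSemidef_sub (by positivity)
    (IsHurwitz.posSemidef_sub_of_lyapunov hK (costMatrix_lyapunov hK) hc h)

theorem stateGramian_lyapunov (S : Matrix (Fin n) (Fin n) ℝ) (hK : K ∈ stabilizing A B) :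
    (A - B * K) * stateGramian A B S K + stateGramian A B S K * (A - B * K)ᵀ + S = 0 := by
  have h := (IsHurwitz.transpose hK).lyapunovIntegral_eq S
  rwa [Matrix.transpose_transpose] at h

theorem posSemidef_stateGramian (hS : S.PosDef) (hK : K ∈ stabilizing A B) :
    (stateGramian A B S K).PosSemidef :=
  (IsHurwitz.transpose hK).posSemidef_lyapunovIntegral hS.posSemidef

theorem posSemidef_stateGramian_sub {s : ℝ} (hs : 0 < s)
    (hS : (S - s • (1 : Matrix (Fin n) (Fin n) ℝ)).PosSemidef) (hK : K ∈ stabilizing A B) :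
    (stateGramian A B S K -
      (s / (2 * ‖A - B * K‖ + 1)) • (1 : Matrix (Fin n) (Fin n) ℝ)).PosSemidef := by
  have h := (IsHurwitz.transpose hK).posSemidef_sub_of_lyapunov
    ((IsHurwitz.transpose hK).lyapunovIntegral_eq S) hs hS
  rwa [Matrix.frobenius_norm_transpose] at h

/-- The dual expression of the cost, through the Gramian instead of the cost matrix. -/
theorem lqrValue_eq_trace_stateGramian (hK : K ∈ stabilizing A B) :
    lqrValue A B Q R S K = ((Q + Kᵀ * R * K) * stateGramian A B S K).trace :=
  trace_mul_eq_of_lyapunov (costMatrix_lyapunov hK) (stateGramian_lyapunov S hK)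

/-- The cost difference of two stabilizing gains, exactly: the difference of the cost matrices
solves a Lyapunov equation whose inhomogeneity is quadratic in the difference of the gains. -/
theorem lqrValue_add_sub (hQ : Q.PosDef) (hR : R.PosDef) (hS : S.PosDef)
    (hK : K ∈ stabilizing A B) (hKD : K + D ∈ stabilizing A B) :
    lqrValue A B Q R S (K + D) - lqrValue A B Q R S K =
      2 * (Dᵀ * gainResidual A B Q R K * stateGramian A B S (K + D)).trace +
        (Dᵀ * R * D * stateGramian A B S (K + D)).trace := by
  have hP := costMatrix_lyapunov (Q := Q) (R := R) hK
  have hP' := costMatrix_lyapunov (Q := Q) (R := R) hKD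
  have hY := stateGramian_lyapunov S hKD
  have hPT := transpose_eq_of_posSemidef (posDef_costMatrix hQ hR hK).posSemidef
  have hYT := transpose_eq_of_posSemidef (posSemidef_stateGramian hS hKD)
  have hRT := transpose_eq_of_posSemidef hR.posSemidef
  rw [lqrValue, lqrValue, gainResidual]
  set P := costMatrix A B Q R K
  set P' := costMatrix A B Q R (K + D)
  set Y := stateGramian A B S (K + D)
  set E := R * K - Bᵀ * P with hE
  have hET : Eᵀ = Kᵀ * R - P * B := by
    rw [hE, Matrix.transpose_sub, Matrix.transpose_mul, Matrix.transpose_mul, hRT, hPT,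
      Matrix.transpose_transpose]
  have hdiff : (A - B * (K + D))ᵀ * (P' - P) + (P' - P) * (A - B * (K + D)) +
      (Dᵀ * E + Eᵀ * D + Dᵀ * R * D) = 0 := by
    have h0 := congrArg₂ (· - ·) hP' hP
    rw [sub_self] at h0
    rw [← h0, hET, hE]
    simp only [Matrix.mul_sub, Matrix.sub_mul, Matrix.mul_add, Matrix.add_mul,
      Matrix.transpose_sub, Matrix.transpose_add, Matrix.transpose_mul, Matrix.mul_assoc]
    abel
  have htr := trace_mul_eq_of_lyapunov hdiff hY
  rw [← Matrix.trace_sub, ← Matrix.sub_mul, htr, Matrix.add_mul, Matrix.add_mul,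
    Matrix.trace_add, Matrix.trace_add, trace_transpose_mul_mul_comm hYT E D]
  ring

/-- The sublevel sets of the cost are bounded, and on them the Gramian is bounded above and
bounded away from zero. The trace of the Gramian is controlled by `Q`, that of the cost matrix by
`S`; a large gain would make the cost large through `R`, because the lower bound on the Gramian
decays only like the inverse of the norm of the gain. -/
theorem exists_sublevel_bounds (hQ : Q.PosDef) (hR : R.PosDef) (hS : S.PosDef)
    (A : Matrix (Fin n) (Fin n) ℝ) (B : Matrix (Fin n) (Fin m) ℝ) {a : ℝ} (ha : 0 ≤ a) :
    ∃ κ c : ℝ, 0 < κ ∧ 0 < c ∧ ∀ K ∈ stabilizing A B, lqrValue A B Q R S K ≤ a →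
      ‖K‖ ≤ κ ∧ ‖gainResidual A B Q R K‖ ≤ κ ∧ (stateGramian A B S K).trace ≤ κ ∧
        (stateGramian A B S K - c • (1 : Matrix (Fin n) (Fin n) ℝ)).PosSemidef := by
  obtain ⟨q, hq, hQ'⟩ := exists_pos_posSemidef_sub hQ
  obtain ⟨r, hr, hR'⟩ := exists_pos_posSemidef_sub hR
  obtain ⟨s, hs, hS'⟩ := exists_pos_posSemidef_sub hS
  set k : ℝ := 1 + a * (2 * ‖A‖ + 1 + 2 * ‖B‖) / (r * s) with hk
  have hk1 : 1 ≤ k := by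
    have : 0 ≤ a * (2 * ‖A‖ + 1 + 2 * ‖B‖) / (r * s) := by positivity
    linarith
  have hk0 : 0 < k := by linarith
  refine ⟨k + (‖R‖ * k + ‖B‖ * (a / s)) + a / q, s / (2 * (‖A‖ + ‖B‖ * k) + 1),
    by positivity, by positivity, fun K hK hKa => ?_⟩
  have hY := posSemidef_stateGramian hS hK
  have hYl := posSemidef_stateGramian_sub hs hS' hK
  have hP := posDef_costMatrix hQ hR hK
  have hval : (costMatrix A B Q R K * S).trace ≤ a := hKa
  rw [lqrValue_eq_trace_stateGramian hK, Matrix.add_mul, Matrix.trace_add] at hKa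
  rw [gainResidual]
  set Y := stateGramian A B S K
  set P := costMatrix A B Q R K
  have hQY := mul_trace_le_trace_mul hQ' hY
  have hKYK : r * (Kᵀ * K * Y).trace ≤ (Kᵀ * R * K * Y).trace := by
    have h := mul_trace_le_trace_mul hR' (hY.mul_mul_conjTranspose_same K)
    rw [Matrix.conjTranspose_eq_transpose_of_trivial, Matrix.trace_mul_comm R,
      Matrix.mul_assoc (K * Y), Matrix.trace_mul_comm (K * Y) (Kᵀ * R), ← Matrix.mul_assoc,
      Matrix.trace_mul_comm (K * Y) Kᵀ, ← Matrix.mul_assoc] at h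
    exact h
  have hKY := mul_norm_sq_le_trace hYl K
  have hKK : 0 ≤ (Kᵀ * K * Y).trace := le_trans (by positivity) hKY
  have hYtr : Y.trace ≤ a / q := by
    rw [le_div_iff₀ hq]
    nlinarith
  have hPtr : ‖P‖ ≤ a / s := by
    have h := mul_trace_le_trace_mul hS' hP.posSemidef
    rw [Matrix.trace_mul_comm] at h
    have h' := norm_le_trace hP.posSemidef
    rw [le_div_iff₀ hs]
    nlinarith
  have hM : ‖A - B * K‖ ≤ ‖A‖ + ‖B‖ * ‖K‖ :=
    (norm_sub_le _ _).trans (by gcongr; exact Matrix.frobenius_norm_mul _ _)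
  -- Otherwise `‖K‖ > 1`, and `r s ‖K‖² ≤ a (2 ‖A - B K‖ + 1)` has a right side linear in `‖K‖`.
  have hKk : ‖K‖ ≤ k := by
    by_contra! hlt
    have h1 : r * (s / (2 * ‖A - B * K‖ + 1) * ‖K‖ ^ 2) ≤ a := by
      have h2 : r * (s / (2 * ‖A - B * K‖ + 1) * ‖K‖ ^ 2) ≤ r * (Kᵀ * K * Y).trace := by gcongr
      have h3 : 0 ≤ q * Y.trace := mul_nonneg hq.le hY.trace_nonneg
      linarith
    have h2 : r * s * ‖K‖ ^ 2 ≤ a * (2 * ‖A - B * K‖ + 1) := by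
      rw [← div_le_iff₀ (by positivity)]
      calc _ = r * (s / (2 * ‖A - B * K‖ + 1) * ‖K‖ ^ 2) := by ring
        _ ≤ a := h1
    have h1K : 1 ≤ ‖K‖ := by linarith
    have h3 : a * (2 * ‖A - B * K‖ + 1) ≤ a * (2 * ‖A‖ + 1 + 2 * ‖B‖) * ‖K‖ := by
      rw [mul_assoc]
      gcongr
      nlinarith [norm_nonneg A, norm_nonneg B]
    have h4 : r * s * ‖K‖ ≤ a * (2 * ‖A‖ + 1 + 2 * ‖B‖) := by
      refine le_of_mul_le_mul_right ?_ (lt_of_lt_of_le one_pos h1K)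
      calc r * s * ‖K‖ * ‖K‖ = r * s * ‖K‖ ^ 2 := by ring
        _ ≤ _ := h2.trans h3
    have h5 : ‖K‖ ≤ a * (2 * ‖A‖ + 1 + 2 * ‖B‖) / (r * s) := by
      rw [le_div_iff₀ (by positivity)]
      linarith
    linarith
  have hE0 : 0 ≤ ‖R‖ * k + ‖B‖ * (a / s) := by positivity
  have haq : 0 ≤ a / q := by positivity
  refine ⟨by linarith, ?_, by linarith, ?_⟩
  · have h : ‖R * K - Bᵀ * P‖ ≤ ‖R‖ * k + ‖B‖ * (a / s) := by
      refine (norm_sub_le _ _).trans (add_le_add ?_ ?_)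
      · exact (Matrix.frobenius_norm_mul _ _).trans (by gcongr)
      · refine (Matrix.frobenius_norm_mul _ _).trans ?_
        rw [Matrix.frobenius_norm_transpose]
        gcongr
    linarith
  · have hcc : s / (2 * (‖A‖ + ‖B‖ * k) + 1) ≤ s / (2 * ‖A - B * K‖ + 1) := by
      have : ‖B‖ * ‖K‖ ≤ ‖B‖ * k := by gcongr
      gcongr
      linarith
    have h := hYl.add (Matrix.PosSemidef.one.smul (sub_nonneg.2 hcc))
    rwa [sub_smul, sub_add_sub_cancel] at h

/-! ### A uniform second-order model of the cost and its gradient -/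

theorem lqrValue_nonneg (hQ : Q.PosDef) (hR : R.PosDef) (hS : S.PosDef)
    (hK : K ∈ stabilizing A B) : 0 ≤ lqrValue A B Q R S K :=
  trace_mul_nonneg (posDef_costMatrix hQ hR hK).posSemidef hS.posSemidef

/-- Stability is preserved under perturbations of the gain whose size depends only on a bound for
the trace of the Gramian: the Gramian of `K` is a Lyapunov certificate for `K + D`. Comparison of
Lyapunov equations then bounds the Gramian of `K + D` and its variation. -/
theorem exists_perturbation_bounds (hS : S.PosDef) (A : Matrix (Fin n) (Fin n) ℝ)
    (B : Matrix (Fin n) (Fin m) ℝ) {κ : ℝ} (hκ : 0 < κ) :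
    ∃ ρ l : ℝ, 0 < ρ ∧ 0 ≤ l ∧ ∀ K ∈ stabilizing A B, (stateGramian A B S K).trace ≤ κ →
      ∀ D, ‖D‖ ≤ ρ → K + D ∈ stabilizing A B ∧ (stateGramian A B S (K + D)).trace ≤ 2 * κ ∧
        ‖stateGramian A B S (K + D) - stateGramian A B S K‖ ≤ l * ‖D‖ := by
  obtain ⟨s, hs, hS'⟩ := exists_pos_posSemidef_sub hS
  refine ⟨s / (4 * (‖B‖ * κ + 1)), 12 * ‖B‖ * κ ^ 2 / s, by positivity, by positivity,
    fun K hK hKκ D hD => ?_⟩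
  have hYpsd := posSemidef_stateGramian hS hK
  have hYpd : (stateGramian A B S K).PosDef :=
    posDef_of_posSemidef_sub (by positivity) (posSemidef_stateGramian_sub hs hS' hK)
  have hY := stateGramian_lyapunov S hK
  have hYT := transpose_eq_of_posSemidef hYpsd
  have hYnorm := (norm_le_trace hYpsd).trans hKκ
  set Y := stateGramian A B S K
  set H : Matrix (Fin n) (Fin n) ℝ := B * D * Y + Y * (B * D)ᵀ with hH
  have hHT : Hᵀ = H := by
    rw [hH, Matrix.transpose_add, Matrix.transpose_mul (B * D), Matrix.transpose_mul Y, hYT,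
      Matrix.transpose_transpose, add_comm]
  -- `η` measures the perturbation `H` of the inhomogeneity relative to `S`.
  set η : ℝ := 2 * ‖B‖ * κ / s * ‖D‖ with hη
  have hη0 : 0 ≤ η := by positivity
  have hη1 : η ≤ 1 / 2 := by
    calc η ≤ 2 * ‖B‖ * κ / s * (s / (4 * (‖B‖ * κ + 1))) := by rw [hη]; gcongr
      _ = ‖B‖ * κ / (2 * (‖B‖ * κ + 1)) := by field_simp; ring
      _ ≤ 1 / 2 := by
        rw [div_le_div_iff₀ (by positivity) (by norm_num)]
        linarith
  have hBD : ‖B * D * Y‖ ≤ ‖B‖ * ‖D‖ * κ :=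
    (Matrix.frobenius_norm_mul _ _).trans
      (mul_le_mul (Matrix.frobenius_norm_mul _ _) hYnorm (norm_nonneg _) (by positivity))
  have hHnorm : ‖H‖ ≤ η * s := by
    have h1 : Y * (B * D)ᵀ = (B * D * Y)ᵀ := by rw [Matrix.transpose_mul (B * D), hYT]
    refine (norm_add_le _ _).trans ?_
    rw [h1, Matrix.frobenius_norm_transpose]
    have h2 : η * s = 2 * (‖B‖ * ‖D‖ * κ) := by rw [hη]; field_simp
    linarith
  have hηS : (η • S - (η * s) • (1 : Matrix (Fin n) (Fin n) ℝ)).PosSemidef := by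
    have := hS'.smul hη0
    rwa [smul_sub, smul_smul] at this
  have hadd : (η • S + H).PosSemidef := by
    have := hηS.add (posSemidef_smul_one_add hHT hHnorm)
    rwa [← add_assoc, sub_add_cancel] at this
  have hsub : (η • S - H).PosSemidef := by
    have := hηS.add (posSemidef_smul_one_sub hHT hHnorm)
    rwa [sub_add_sub_cancel] at this
  have hYeq : (A - B * (K + D)) * Y + Y * (A - B * (K + D))ᵀ + (S + H) = 0 := by
    rw [← hY, hH]
    simp only [Matrix.mul_sub, Matrix.sub_mul, Matrix.mul_add, Matrix.add_mul,
      Matrix.transpose_sub, Matrix.transpose_add, Matrix.mul_assoc]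
    abel
  have hstab : IsHurwitz (A - B * (K + D))ᵀ := by
    refine isHurwitz_of_lyapunov (W := S + H) hYpd ?_ (by rwa [Matrix.transpose_transpose])
    have := (hS.smul (show (0 : ℝ) < 1 - η by linarith)).add_posSemidef hadd
    rwa [← add_assoc, ← add_smul, sub_add_cancel, one_smul] at this
  have hKD : K + D ∈ stabilizing A B := by
    have := hstab.transpose
    rwa [Matrix.transpose_transpose] at this
  have hY' := stateGramian_lyapunov S hKD
  have hY'psd := posSemidef_stateGramian hS hKD
  set Y' := stateGramian A B S (K + D)
  have hcomp : ∀ {Z V : Matrix (Fin n) (Fin n) ℝ}, V.PosSemidef →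
      (A - B * (K + D)) * Z + Z * (A - B * (K + D))ᵀ + V = 0 → Z.PosSemidef := fun hV hZ =>
    hstab.posSemidef_of_lyapunov (by rwa [Matrix.transpose_transpose]) hV
  -- Combinations of the Lyapunov equations of both Gramians for the perturbed closed loop.
  have hlin : ∀ p q : ℝ, (A - B * (K + D)) * (p • Y' + q • Y) +
      (p • Y' + q • Y) * (A - B * (K + D))ᵀ + (p • S + q • (S + H)) = 0 := fun p q => by
    have h : p • ((A - B * (K + D)) * Y' + Y' * (A - B * (K + D))ᵀ + S) +
        q • ((A - B * (K + D)) * Y + Y * (A - B * (K + D))ᵀ + (S + H)) = 0 := by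
      rw [hY', hYeq, smul_zero, smul_zero, add_zero]
    rw [← h]
    simp only [Matrix.mul_add, Matrix.add_mul, Matrix.mul_smul, Matrix.smul_mul, smul_add]
    abel
  have hup : (-(1 - η) • Y' + (1 : ℝ) • Y).PosSemidef := by
    refine hcomp ?_ (hlin _ _)
    convert hadd using 1
    module
  have hz1 : ((η - 1) • Y' + (1 : ℝ) • Y).PosSemidef := by
    refine hcomp ?_ (hlin _ _)
    convert hadd using 1
    module
  have hz2 : ((η + 1) • Y' + (-1 : ℝ) • Y).PosSemidef := by
    refine hcomp ?_ (hlin _ _)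
    convert hsub using 1
    module
  have htr : Y'.trace ≤ 2 * κ := by
    have h1 := hup.trace_nonneg
    have h2 := hY'psd.trace_nonneg
    simp only [Matrix.trace_add, Matrix.trace_smul, smul_eq_mul] at h1
    nlinarith
  refine ⟨hKD, htr, ?_⟩
  have hz := norm_le_of_sandwich (X := η • Y') (Z := Y' - Y) (hY'psd.smul hη0)
    (by convert hz1 using 1; module) (by convert hz2 using 1; module)
  rw [Matrix.trace_smul, smul_eq_mul] at hz
  calc ‖Y' - Y‖ ≤ 3 * (η * Y'.trace) := hz
    _ ≤ 3 * (η * (2 * κ)) := by gcongr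
    _ = 12 * ‖B‖ * κ ^ 2 / s * ‖D‖ := by rw [hη]; ring

/-- On a sublevel set, the cost agrees with its linearization up to a uniform quadratic error, on
balls of a uniform radius on which the gains remain stabilizing. -/
theorem exists_quadratic_model (hQ : Q.PosDef) (hR : R.PosDef) (hS : S.PosDef)
    (A : Matrix (Fin n) (Fin n) ℝ) (B : Matrix (Fin n) (Fin m) ℝ) {a : ℝ} (ha : 0 ≤ a) :
    ∃ ρ l : ℝ, 0 < ρ ∧ 0 < l ∧ ∀ K ∈ stabilizing A B, lqrValue A B Q R S K ≤ a →
      ∀ D, ‖D‖ ≤ ρ → K + D ∈ stabilizing A B ∧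
        |lqrValue A B Q R S (K + D) - lqrValue A B Q R S K -
          (Dᵀ * ((2 : ℝ) • (gainResidual A B Q R K * stateGramian A B S K))).trace| ≤
            l * ‖D‖ ^ 2 := by
  obtain ⟨κ, c, hκ, -, hbd⟩ := exists_sublevel_bounds hQ hR hS A B ha
  obtain ⟨ρ, l, hρ, hl, hpert⟩ := exists_perturbation_bounds hS A B hκ
  refine ⟨ρ, 2 * κ * l + ‖R‖ * (2 * κ) + 1, hρ, by positivity, fun K hK hKa D hD => ?_⟩
  obtain ⟨-, hE, hYtr, -⟩ := hbd K hK hKa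
  obtain ⟨hKD, htr', hYdiff⟩ := hpert K hK hYtr D hD
  refine ⟨hKD, ?_⟩
  have hY' := (norm_le_trace (posSemidef_stateGramian hS hKD)).trans htr'
  rw [lqrValue_add_sub hQ hR hS hK hKD]
  set E := gainResidual A B Q R K
  set Y := stateGramian A B S K
  set Y' := stateGramian A B S (K + D)
  have hsplit : 2 * (Dᵀ * E * Y').trace + (Dᵀ * R * D * Y').trace -
      (Dᵀ * ((2 : ℝ) • (E * Y))).trace =
      2 * (Dᵀ * (E * (Y' - Y))).trace + (Dᵀ * (R * D * Y')).trace := by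
    simp only [Matrix.mul_sub, Matrix.trace_sub, Matrix.mul_smul, Matrix.trace_smul,
      Matrix.mul_assoc, smul_eq_mul]
    ring
  have h1 : |(Dᵀ * (E * (Y' - Y))).trace| ≤ ‖D‖ * (κ * (l * ‖D‖)) :=
    (abs_trace_transpose_mul_le _ _).trans (mul_le_mul_of_nonneg_left
      ((Matrix.frobenius_norm_mul _ _).trans (by gcongr)) (norm_nonneg _))
  have h2 : |(Dᵀ * (R * D * Y')).trace| ≤ ‖D‖ * (‖R‖ * ‖D‖ * (2 * κ)) :=
    (abs_trace_transpose_mul_le _ _).trans (mul_le_mul_of_nonneg_left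
      ((Matrix.frobenius_norm_mul _ _).trans (mul_le_mul (Matrix.frobenius_norm_mul _ _) hY'
        (norm_nonneg _) (by positivity))) (norm_nonneg _))
  rw [hsplit]
  refine (abs_add_le _ _).trans ?_
  rw [abs_mul, abs_two]
  nlinarith [sq_nonneg ‖D‖]

theorem cost_eq_lqrValue (Q : Matrix (Fin n) (Fin n) ℝ) (R : Matrix (Fin m) (Fin m) ℝ)
    (S : Matrix (Fin n) (Fin n) ℝ) (hK : K ∈ stabilizing A B) :
    cost A B Q R S K = (lqrValue A B Q R S K : EReal) :=
  if_pos hK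

/-- The functional `D ↦ ⟨G, D⟩` for the Frobenius inner product. -/
noncomputable def frobeniusDual (G : Matrix (Fin m) (Fin n) ℝ) : Matrix (Fin m) (Fin n) ℝ →L[ℝ] ℝ :=
  LinearMap.toContinuousLinearMap
    { toFun := fun D => (Dᵀ * G).trace
      map_add' := fun D D' => by simp [Matrix.add_mul]
      map_smul' := fun t D => by simp }

theorem frobeniusDual_apply (G D : Matrix (Fin m) (Fin n) ℝ) :
    frobeniusDual G D = (Dᵀ * G).trace :=
  rfl

/-- The gradient is read off from the quadratic model on the sublevel set of `K` itself. -/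
theorem hasFDerivAt_cost (hQ : Q.PosDef) (hR : R.PosDef) (hS : S.PosDef)
    (hK : K ∈ stabilizing A B) :
    HasFDerivAt (fun L => (cost A B Q R S L).toReal)
      (frobeniusDual ((2 : ℝ) • (gainResidual A B Q R K * stateGramian A B S K))) K := by
  obtain ⟨ρ, l, hρ, hl, hquad⟩ :=
    exists_quadratic_model hQ hR hS A B (lqrValue_nonneg hQ hR hS hK)
  refine hasFDerivAt_iff_isLittleO_nhds_zero.2 ?_
  have hO : (fun D : Matrix (Fin m) (Fin n) ℝ => (cost A B Q R S (K + D)).toReal -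
      (cost A B Q R S K).toReal -
      frobeniusDual ((2 : ℝ) • (gainResidual A B Q R K * stateGramian A B S K)) D) =O[𝓝 0]
        fun D => ‖D‖ ^ 2 := by
    refine IsBigO.of_bound l ?_
    filter_upwards [Metric.closedBall_mem_nhds (0 : Matrix (Fin m) (Fin n) ℝ) hρ] with D hD
    obtain ⟨hKD, h⟩ := hquad K hK le_rfl D (by simpa using hD)
    rw [cost_eq_lqrValue Q R S hK, cost_eq_lqrValue Q R S hKD, EReal.toReal_coe, EReal.toReal_coe,
      Real.norm_eq_abs, norm_pow, norm_norm]
    exact h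
  exact hO.trans_isLittleO (isLittleO_norm_pow_id one_lt_two)

theorem costGradient_eq (hQ : Q.PosDef) (hR : R.PosDef) (hS : S.PosDef)
    (hK : K ∈ stabilizing A B) :
    costGradient A B Q R S K =
      (2 : ℝ) • (gainResidual A B Q R K * stateGramian A B S K) := by
  ext i j
  have h : fderiv ℝ (fun L => (cost A B Q R S L).toReal) K = _ :=
    (hasFDerivAt_cost hQ hR hS hK).fderiv
  rw [costGradient, matrixGradient, Matrix.of_apply, h, frobeniusDual_apply,
    Matrix.transpose_single, Matrix.trace_mul_comm, Matrix.trace_mul_single]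
  simp

/-! ### The Riccati equation and the optimal gain -/

theorem continuousAt_cost (hQ : Q.PosDef) (hR : R.PosDef) (hS : S.PosDef)
    (hK : K ∈ stabilizing A B) : ContinuousAt (fun L => (cost A B Q R S L).toReal) K :=
  (hasFDerivAt_cost hQ hR hS hK).continuousAt

/-- Sublevel sets are closed because the radius on which gains remain stabilizing is uniform: a
limit of gains in the set lies within that radius of one of them. -/
theorem isCompact_sublevel (hQ : Q.PosDef) (hR : R.PosDef) (hS : S.PosDef)
    (A : Matrix (Fin n) (Fin n) ℝ) (B : Matrix (Fin n) (Fin m) ℝ) {a : ℝ} (ha : 0 ≤ a) :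
    IsCompact {K ∈ stabilizing A B | lqrValue A B Q R S K ≤ a} := by
  have : ProperSpace (Matrix (Fin m) (Fin n) ℝ) := FiniteDimensional.proper ℝ _
  obtain ⟨κ, c, -, -, hbd⟩ := exists_sublevel_bounds hQ hR hS A B ha
  obtain ⟨ρ, l, hρ, -, hquad⟩ := exists_quadratic_model hQ hR hS A B ha
  refine Metric.isCompact_of_isClosed_isBounded (isClosed_of_closure_subset fun K hK => ?_)
    (isBounded_iff_forall_norm_le.2 ⟨κ, fun K hK => (hbd K hK.1 hK.2).1⟩)
  have hKs : K ∈ stabilizing A B := by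
    obtain ⟨L, hL, hKL⟩ := Metric.mem_closure_iff.1 hK ρ hρ
    have h := (hquad L hL.1 hL.2 (K - L) (by rw [← dist_eq_norm]; exact hKL.le)).1
    rwa [add_sub_cancel] at h
  refine ⟨hKs, ?_⟩
  by_contra! hlt
  have hcont := continuousAt_cost hQ hR hS hKs
  have hev : ∀ᶠ L in 𝓝 K, a < (cost A B Q R S L).toReal :=
    hcont.eventually (lt_mem_nhds
      (by simpa only [cost_eq_lqrValue Q R S hKs, EReal.toReal_coe] using hlt))
  obtain ⟨L, hL, hL'⟩ := ((mem_closure_iff_frequently.1 hK).and_eventually hev).exists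
  rw [cost_eq_lqrValue Q R S hL.1, EReal.toReal_coe] at hL'
  exact absurd hL.2 (not_le.2 hL')

/-- If there is a stabilizing gain, then the Riccati equation has a positive definite solution:
the cost attains its minimum on a compact sublevel set, its gradient `2 E Y` vanishes there, and
the vanishing of `E` turns the Lyapunov equation of the cost matrix into the Riccati equation. -/
theorem exists_isRiccatiSolution (hQ : Q.PosDef) (hR : R.PosDef)
    (hK : K ∈ stabilizing A B) : ∃ P, IsRiccatiSolution A B Q R P := by
  have hS : (1 : Matrix (Fin n) (Fin n) ℝ).PosDef := Matrix.PosDef.one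
  have ha := lqrValue_nonneg hQ hR hS hK
  obtain ⟨ρ, l, hρ, -, hquad⟩ := exists_quadratic_model hQ hR hS A B ha
  obtain ⟨K₁, ⟨hK₁, hK₁a⟩, hmin⟩ := (isCompact_sublevel hQ hR hS A B ha).exists_isMinOn
    ⟨K, hK, le_rfl⟩ (fun L hL => (continuousAt_cost hQ hR hS hL.1).continuousWithinAt)
  have hlocal : IsLocalMin (fun L => (cost A B Q R 1 L).toReal) K₁ := by
    filter_upwards [Metric.closedBall_mem_nhds K₁ hρ] with L hL
    have hLs := (hquad K₁ hK₁ hK₁a (L - K₁) (by rw [← dist_eq_norm]; exact hL)).1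
    rw [add_sub_cancel] at hLs
    rcases le_total (lqrValue A B Q R 1 L) (lqrValue A B Q R 1 K) with h | h
    · exact hmin ⟨hLs, h⟩
    · rw [cost_eq_lqrValue Q R 1 hK₁, cost_eq_lqrValue Q R 1 hLs]
      exact hK₁a.trans h
  have hgrad := hlocal.hasFDerivAt_eq_zero (hasFDerivAt_cost hQ hR hS hK₁)
  set G := (2 : ℝ) • (gainResidual A B Q R K₁ * stateGramian A B 1 K₁) with hG
  have hG0 : G = 0 := by
    have h : ‖G‖ ^ 2 = 0 := by
      rw [norm_sq_eq_trace, ← frobeniusDual_apply, hgrad]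
      rfl
    exact norm_eq_zero.1 (by simpa using h)
  have hE : gainResidual A B Q R K₁ = 0 := by
    have hY : (stateGramian A B 1 K₁).PosDef := by
      obtain ⟨s, hs, hS'⟩ := exists_pos_posSemidef_sub hS
      exact posDef_of_posSemidef_sub (by positivity) (posSemidef_stateGramian_sub hs hS' hK₁)
    have hdet := (Matrix.isUnit_iff_isUnit_det _).1 hY.isUnit
    have h : gainResidual A B Q R K₁ * stateGramian A B 1 K₁ = 0 :=
      (smul_eq_zero.1 (hG.symm.trans hG0)).resolve_left two_ne_zero
    have h' := congrArg (· * (stateGramian A B 1 K₁)⁻¹) h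
    simpa [Matrix.mul_assoc, Matrix.mul_nonsing_inv _ hdet] using h'
  have hP := posDef_costMatrix hQ hR hK₁
  have hlyap := costMatrix_lyapunov (Q := Q) (R := R) hK₁
  rw [gainResidual] at hE
  refine ⟨costMatrix A B Q R K₁, hP, ?_⟩
  have hPT := transpose_eq_of_posSemidef hP.posSemidef
  have hRT := transpose_eq_of_posSemidef hR.posSemidef
  set P := costMatrix A B Q R K₁
  have hRdet := (Matrix.isUnit_iff_isUnit_det _).1 hR.isUnit
  have hRK : R * K₁ = Bᵀ * P := sub_eq_zero.1 hE
  have hKR : K₁ᵀ * R = P * B := by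
    have h := congrArg Matrix.transpose hRK
    rwa [Matrix.transpose_mul, Matrix.transpose_mul, hRT, hPT, Matrix.transpose_transpose] at h
  have hKeq : K₁ = R⁻¹ * (Bᵀ * P) := by
    rw [← hRK, ← Matrix.mul_assoc, Matrix.nonsing_inv_mul _ hRdet, Matrix.one_mul]
  have h1 : P * B * R⁻¹ * Bᵀ * P = P * (B * K₁) := by
    rw [hKeq]
    simp only [Matrix.mul_assoc]
  have h2 : (B * K₁)ᵀ * P = P * (B * K₁) := by
    rw [Matrix.transpose_mul, Matrix.mul_assoc, ← hRK, ← Matrix.mul_assoc, hKR, Matrix.mul_assoc]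
  rw [h1, ← hlyap, hKR, Matrix.transpose_sub, Matrix.sub_mul, Matrix.mul_sub, h2,
    Matrix.mul_assoc P B K₁]
  abel

theorem isRiccatiSolution_riccatiSolution (hQ : Q.PosDef) (hR : R.PosDef)
    (hK : K ∈ stabilizing A B) : IsRiccatiSolution A B Q R (riccatiSolution A B Q R) := by
  have h := exists_isRiccatiSolution hQ hR hK
  rw [riccatiSolution, dif_pos h]
  exact h.choose_spec

/-- The gain of a positive definite solution `P` of the Riccati equation is stabilizing, because
`P` solves the associated Lyapunov equation, and its residual vanishes. -/
theorem optimalGain_spec (hQ : Q.PosDef) (hR : R.PosDef) (hK : K ∈ stabilizing A B) :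
    optimalGain A B Q R ∈ stabilizing A B ∧
      gainResidual A B Q R (optimalGain A B Q R) = 0 := by
  obtain ⟨hP, hric⟩ := isRiccatiSolution_riccatiSolution hQ hR hK
  have hPT := transpose_eq_of_posSemidef hP.posSemidef
  have hRT := transpose_eq_of_posSemidef hR.posSemidef
  have hRdet := (Matrix.isUnit_iff_isUnit_det _).1 hR.isUnit
  have hdef : optimalGain A B Q R = R⁻¹ * Bᵀ * riccatiSolution A B Q R := rfl
  set P := riccatiSolution A B Q R
  set L := optimalGain A B Q R
  have hRL : R * L = Bᵀ * P := by
    rw [hdef, Matrix.mul_assoc, ← Matrix.mul_assoc R, Matrix.mul_nonsing_inv _ hRdet,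
      Matrix.one_mul]
  have hLR : Lᵀ * R = P * B := by
    have h := congrArg Matrix.transpose hRL
    rwa [Matrix.transpose_mul, Matrix.transpose_mul, hRT, hPT, Matrix.transpose_transpose] at h
  have h1 : P * B * R⁻¹ * Bᵀ * P = P * (B * L) := by
    rw [hdef]
    simp only [Matrix.mul_assoc]
  have h2 : (B * L)ᵀ * P = P * (B * L) := by
    rw [Matrix.transpose_mul, Matrix.mul_assoc, ← hRL, ← Matrix.mul_assoc, hLR, Matrix.mul_assoc]
  have hlyap : (A - B * L)ᵀ * P + P * (A - B * L) + (Q + Lᵀ * R * L) = 0 := by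
    rw [← hric, h1, hLR, Matrix.transpose_sub, Matrix.sub_mul, Matrix.mul_sub, h2,
      Matrix.mul_assoc P B L]
    abel
  have hstab : L ∈ stabilizing A B := isHurwitz_of_lyapunov hP (posDef_stageCost hQ hR L) hlyap
  refine ⟨hstab, ?_⟩
  have hPL : costMatrix A B Q R L = P :=
    IsHurwitz.lyapunov_unique hstab (costMatrix_lyapunov hstab) hlyap
  rw [gainResidual, hPL, hRL, sub_self]

/-! ### Growth of the cost and gradient domination -/

/-- At the optimal gain the linear term of the exact cost difference vanishes. -/
theorem lqrValue_sub_optimal (hQ : Q.PosDef) (hR : R.PosDef) (hS : S.PosDef)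
    (hK : K ∈ stabilizing A B) :
    lqrValue A B Q R S K - lqrValue A B Q R S (optimalGain A B Q R) =
      ((K - optimalGain A B Q R)ᵀ * R * (K - optimalGain A B Q R) *
        stateGramian A B S K).trace := by
  obtain ⟨hL, hE⟩ := optimalGain_spec hQ hR hK
  have h := lqrValue_add_sub (D := K - optimalGain A B Q R) hQ hR hS hL (by rwa [add_sub_cancel])
  rw [add_sub_cancel, hE] at h
  simpa using h

theorem lqrValue_optimal_le (hQ : Q.PosDef) (hR : R.PosDef) (hS : S.PosDef)
    (hK : K ∈ stabilizing A B) :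
    lqrValue A B Q R S (optimalGain A B Q R) ≤ lqrValue A B Q R S K := by
  rw [← sub_nonneg, lqrValue_sub_optimal hQ hR hS hK]
  exact trace_mul_nonneg
    (by simpa using hR.posSemidef.conjTranspose_mul_mul_same (K - optimalGain A B Q R))
    (posSemidef_stateGramian hS hK)

/-- The suboptimality of a gain is controlled by its residual: complete the square in the exact
cost difference to the optimal gain. -/
theorem lqrValue_sub_optimal_le (hQ : Q.PosDef) (hR : R.PosDef) (hS : S.PosDef)
    (hK : K ∈ stabilizing A B) :
    lqrValue A B Q R S K - lqrValue A B Q R S (optimalGain A B Q R) ≤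
      ‖R⁻¹‖ * (stateGramian A B S (optimalGain A B Q R)).trace *
        ‖gainResidual A B Q R K‖ ^ 2 := by
  obtain ⟨hL, -⟩ := optimalGain_spec hQ hR hK
  have h := lqrValue_add_sub (D := optimalGain A B Q R - K) hQ hR hS hK (by rwa [add_sub_cancel])
  rw [add_sub_cancel] at h
  have hY := posSemidef_stateGramian hS hL
  have hYT := transpose_eq_of_posSemidef hY
  have hRT := transpose_eq_of_posSemidef hR.posSemidef
  have hRdet := (Matrix.isUnit_iff_isUnit_det _).1 hR.isUnit
  set D := optimalGain A B Q R - K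
  set E := gainResidual A B Q R K
  set Y := stateGramian A B S (optimalGain A B Q R)
  have hsq : (R * D + E)ᵀ * R⁻¹ * (R * D + E) =
      Dᵀ * R * D + Dᵀ * E + Eᵀ * D + Eᵀ * R⁻¹ * E := by
    have h1 : (R * D)ᵀ * R⁻¹ = Dᵀ := by
      rw [Matrix.transpose_mul, hRT, Matrix.mul_assoc, Matrix.mul_nonsing_inv _ hRdet,
        Matrix.mul_one]
    have h2 : Eᵀ * R⁻¹ * (R * D) = Eᵀ * D := by
      rw [Matrix.mul_assoc, ← Matrix.mul_assoc R⁻¹, Matrix.nonsing_inv_mul _ hRdet,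
        Matrix.one_mul]
    rw [Matrix.transpose_add, Matrix.add_mul, Matrix.add_mul, Matrix.mul_add, Matrix.mul_add, h1,
      h2, Matrix.mul_assoc Dᵀ R D]
    abel
  have hnn := trace_mul_nonneg (X := (R * D + E)ᵀ * R⁻¹ * (R * D + E))
    (by simpa using hR.inv.posSemidef.conjTranspose_mul_mul_same (R * D + E)) hY
  rw [hsq, Matrix.add_mul, Matrix.add_mul, Matrix.add_mul, Matrix.trace_add, Matrix.trace_add,
    Matrix.trace_add, trace_transpose_mul_mul_comm hYT E D] at hnn
  have hle : (Eᵀ * R⁻¹ * E * Y).trace ≤ ‖R⁻¹‖ * Y.trace * ‖E‖ ^ 2 := by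
    rw [Matrix.mul_assoc, Matrix.mul_assoc]
    calc (Eᵀ * (R⁻¹ * (E * Y))).trace ≤ ‖E‖ * ‖R⁻¹ * (E * Y)‖ := trace_transpose_mul_le _ _
      _ ≤ ‖E‖ * (‖R⁻¹‖ * (‖E‖ * Y.trace)) := by
        gcongr
        refine (Matrix.frobenius_norm_mul _ _).trans ?_
        gcongr
        exact (Matrix.frobenius_norm_mul _ _).trans (by gcongr; exact norm_le_trace hY)
      _ = _ := by ring
  linarith

theorem mul_norm_le_norm_mul {Y : Matrix (Fin n) (Fin n) ℝ} {c : ℝ}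
    (hY : (Y - c • (1 : Matrix (Fin n) (Fin n) ℝ)).PosSemidef) (E : Matrix (Fin m) (Fin n) ℝ) :
    c * ‖E‖ ≤ ‖E * Y‖ := by
  rcases (norm_nonneg E).eq_or_lt with h0 | h0
  · rw [← h0, mul_zero]
    exact norm_nonneg _
  · refine le_of_mul_le_mul_left ?_ h0
    have h := (mul_norm_sq_le_trace hY E).trans
      ((Matrix.mul_assoc Eᵀ E Y).symm ▸ trace_transpose_mul_le E (E * Y))
    linarith

/-! ### Contraction along inexact gradient steps -/

/-- The error estimates on a sublevel set: a gradient step with relative error below `1 / 2` stays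
in the sublevel set and contracts the suboptimality, and the suboptimality is comparable to the
squared distance to the optimal gain. -/
theorem exists_contraction_constants (hQ : Q.PosDef) (hR : R.PosDef) (hS : S.PosDef)
    (A : Matrix (Fin n) (Fin n) ℝ) (B : Matrix (Fin n) (Fin m) ℝ) {a : ℝ} (ha : 0 ≤ a) :
    ∃ μ σm p q : ℝ, 0 < σm ∧ σm < μ ∧ 0 < p ∧ 0 < q ∧
      ∀ K ∈ stabilizing A B, lqrValue A B Q R S K ≤ a →
        (p * ‖K - optimalGain A B Q R‖ ^ 2 ≤
            lqrValue A B Q R S K - lqrValue A B Q R S (optimalGain A B Q R)) ∧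
        (lqrValue A B Q R S K - lqrValue A B Q R S (optimalGain A B Q R) ≤
            q * ‖K - optimalGain A B Q R‖ ^ 2) ∧
        ∀ θ, θ < 1 / 2 → ∀ σ, 0 ≤ σ → σ ≤ σm → ∀ G,
          IsRobustEstimate A B Q R S θ K G →
            K - σ • G ∈ stabilizing A B ∧ lqrValue A B Q R S (K - σ • G) ≤ a ∧
              lqrValue A B Q R S (K - σ • G) - lqrValue A B Q R S (optimalGain A B Q R) ≤
                (1 - σ / μ) *
                  (lqrValue A B Q R S K - lqrValue A B Q R S (optimalGain A B Q R)) := by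
  obtain ⟨r, hr, hR'⟩ := exists_pos_posSemidef_sub hR
  obtain ⟨κ, c, hκ, hc, hbd⟩ := exists_sublevel_bounds hQ hR hS A B ha
  obtain ⟨ρ, l, hρ, hl, hquad⟩ := exists_quadratic_model hQ hR hS A B ha
  -- `τ` is the constant of gradient domination.
  set τ : ℝ := ‖R⁻¹‖ * κ / (4 * c ^ 2) + 1 with hτ
  have hτ0 : 0 < τ := by positivity
  refine ⟨4 * τ, min (min (ρ / (3 * κ ^ 2)) (1 / (9 * l))) (2 * τ), r * c, ‖R‖ * κ + 1,
    by positivity, (min_le_right _ _).trans_lt (by linarith), by positivity, by positivity,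
    fun K hK hKa => ?_⟩
  obtain ⟨-, hE, hYtr, hYc⟩ := hbd K hK hKa
  obtain ⟨hL, -⟩ := optimalGain_spec hQ hR hK
  have hopt := lqrValue_optimal_le hQ hR hS hK
  have hYL := (hbd _ hL (hopt.trans hKa)).2.2.1
  have hPL := lqrValue_sub_optimal_le hQ hR hS hK
  have hY := posSemidef_stateGramian hS hK
  have hYn := (norm_le_trace hY).trans hYtr
  refine ⟨?_, ?_, fun θ hθ σ hσ hσm G hG => ?_⟩
  · rw [lqrValue_sub_optimal hQ hR hS hK]
    set D := K - optimalGain A B Q R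
    have h1 := mul_norm_sq_le_trace hYc D
    have h2 := mul_trace_le_trace_mul hR' (hY.mul_mul_conjTranspose_same D)
    have h3 : (R * (D * stateGramian A B S K * Dᴴ)).trace =
        (Dᵀ * R * D * stateGramian A B S K).trace := by
      rw [Matrix.conjTranspose_eq_transpose_of_trivial, ← Matrix.mul_assoc,
        Matrix.trace_mul_comm]
      simp only [Matrix.mul_assoc]
    have h4 : (D * stateGramian A B S K * Dᴴ).trace = (Dᵀ * D * stateGramian A B S K).trace := by
      rw [Matrix.conjTranspose_eq_transpose_of_trivial, Matrix.trace_mul_comm, Matrix.mul_assoc]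
    rw [h3, h4] at h2
    rw [mul_assoc]
    exact (mul_le_mul_of_nonneg_left h1 hr.le).trans h2
  · rw [lqrValue_sub_optimal hQ hR hS hK, Matrix.mul_assoc, Matrix.mul_assoc]
    set D := K - optimalGain A B Q R
    calc _ ≤ ‖D‖ * ‖R * (D * stateGramian A B S K)‖ := trace_transpose_mul_le _ _
      _ ≤ ‖D‖ * (‖R‖ * (‖D‖ * κ)) := by
        gcongr
        refine (Matrix.frobenius_norm_mul _ _).trans ?_
        gcongr
        exact (Matrix.frobenius_norm_mul _ _).trans (by gcongr)
      _ = ‖R‖ * κ * ‖D‖ ^ 2 := by ring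
      _ ≤ (‖R‖ * κ + 1) * ‖D‖ ^ 2 := by gcongr; linarith
  · rw [IsRobustEstimate, costGradient_eq hQ hR hS hK] at hG
    change ‖G - _‖ ≤ θ * ‖_‖ at hG
    have hσ1 : σ ≤ ρ / (3 * κ ^ 2) := hσm.trans ((min_le_left _ _).trans (min_le_left _ _))
    have hσ2 : σ ≤ 1 / (9 * l) := hσm.trans ((min_le_left _ _).trans (min_le_right _ _))
    have hmodel := hquad K hK hKa (-(σ • G))
    rw [← sub_eq_add_neg, norm_neg, norm_smul, Real.norm_of_nonneg hσ] at hmodel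
    set Γ := (2 : ℝ) • (gainResidual A B Q R K * stateGramian A B S K) with hΓ
    have hΓnorm : ‖Γ‖ = 2 * ‖gainResidual A B Q R K * stateGramian A B S K‖ := by
      rw [hΓ, norm_smul, Real.norm_of_nonneg zero_le_two]
    have hΓκ : ‖Γ‖ ≤ 2 * κ ^ 2 := by
      rw [hΓnorm, sq]
      gcongr
      exact (Matrix.frobenius_norm_mul _ _).trans (by gcongr)
    have hdom : lqrValue A B Q R S K - lqrValue A B Q R S (optimalGain A B Q R) ≤
        τ * ‖Γ‖ ^ 2 := by
      have hcE : c * ‖gainResidual A B Q R K‖ ≤ ‖Γ‖ / 2 := by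
        rw [hΓnorm, mul_div_cancel_left₀ _ two_ne_zero]
        exact mul_norm_le_norm_mul hYc _
      have hE2 : ‖gainResidual A B Q R K‖ ^ 2 ≤ ‖Γ‖ ^ 2 / (4 * c ^ 2) := by
        rw [le_div_iff₀ (by positivity)]
        have := pow_le_pow_left₀ (by positivity) hcE 2
        linarith
      calc _ ≤ _ := hPL
        _ ≤ ‖R⁻¹‖ * κ * (‖Γ‖ ^ 2 / (4 * c ^ 2)) := by gcongr
        _ = ‖R⁻¹‖ * κ / (4 * c ^ 2) * ‖Γ‖ ^ 2 := by ring
        _ ≤ τ * ‖Γ‖ ^ 2 := by gcongr; linarith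
    have hGΓ : ‖G - Γ‖ ≤ 1 / 2 * ‖Γ‖ := hG.trans (by gcongr)
    have hGn : ‖G‖ ≤ 3 / 2 * ‖Γ‖ := by
      have := norm_add_le (G - Γ) Γ
      rw [sub_add_cancel] at this
      linarith
    have hstep : σ * ‖G‖ ≤ ρ := by
      calc σ * ‖G‖ ≤ ρ / (3 * κ ^ 2) * (3 / 2 * (2 * κ ^ 2)) := by
            gcongr
            exact hGn.trans (by gcongr)
        _ = ρ := by field_simp
    obtain ⟨hstab, hval⟩ := hmodel hstep
    have hinner : 1 / 2 * ‖Γ‖ ^ 2 ≤ (Gᵀ * Γ).trace := by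
      have h1 := neg_le_of_abs_le (abs_trace_transpose_mul_le (G - Γ) Γ)
      rw [Matrix.transpose_sub, Matrix.sub_mul, Matrix.trace_sub, ← norm_sq_eq_trace] at h1
      nlinarith [norm_nonneg Γ]
    have htr : ((-(σ • G))ᵀ * Γ).trace = -(σ * (Gᵀ * Γ).trace) := by
      simp [Matrix.transpose_neg, Matrix.transpose_smul]
    rw [htr] at hval
    have hval' := (abs_le.1 hval).2
    have hquad' : l * (σ * ‖G‖) ^ 2 ≤ σ * (1 / 4 * ‖Γ‖ ^ 2) := by
      have h9 : σ * (9 * l) ≤ 1 := (le_div_iff₀ (by positivity)).1 hσ2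
      calc l * (σ * ‖G‖) ^ 2 ≤ l * (σ * (3 / 2 * ‖Γ‖)) ^ 2 := by gcongr
        _ = σ * (9 * l) * (σ * (1 / 4 * ‖Γ‖ ^ 2)) := by ring
        _ ≤ 1 * (σ * (1 / 4 * ‖Γ‖ ^ 2)) := by gcongr
        _ = _ := one_mul _
    have hdec : lqrValue A B Q R S (K - σ • G) ≤
        lqrValue A B Q R S K - σ * (1 / 4 * ‖Γ‖ ^ 2) := by
      have := mul_le_mul_of_nonneg_left hinner hσ
      linarith
    refine ⟨hstab, ?_, ?_⟩
    · have : 0 ≤ σ * (1 / 4 * ‖Γ‖ ^ 2) := by positivity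
      linarith
    · have h1 : σ / (4 * τ) *
          (lqrValue A B Q R S K - lqrValue A B Q R S (optimalGain A B Q R)) ≤
            σ * (1 / 4 * ‖Γ‖ ^ 2) := by
        calc _ ≤ σ / (4 * τ) * (τ * ‖Γ‖ ^ 2) := by gcongr
          _ = σ * (1 / 4 * ‖Γ‖ ^ 2) := by field_simp
      linarith

end LQR

theorem mainTheorem7 {n m : ℕ}
    (A : Matrix (Fin n) (Fin n) ℝ) (B : Matrix (Fin n) (Fin m) ℝ)
    (Q : Matrix (Fin n) (Fin n) ℝ) (R : Matrix (Fin m) (Fin m) ℝ)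
    (S : Matrix (Fin n) (Fin n) ℝ)
    (hAB : LQR.IsControllable A B) (hQ : Q.PosDef) (hR : R.PosDef) (hS : S.PosDef) (a : ℝ) :
    ∃ μ σm b : ℝ, 0 < σm ∧ σm < μ ∧ 0 < b ∧
      ∀ (K₀ : Matrix (Fin m) (Fin n) ℝ), K₀ ∈ LQR.stabilizing A B →
        LQR.cost A B Q R S K₀ = (a : EReal) →
        ∀ (θ : ℝ), 0 ≤ θ → θ < 1 / 2 →
        ∀ (σ : ℝ), 0 ≤ σ → σ ≤ σm →
        ∀ (N : ℕ) (K : ℕ → Matrix (Fin m) (Fin n) ℝ), K 0 = K₀ →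
          LQR.IsPolicyGradientRun A B Q R S θ σ N K →
          ∀ k ≤ N,
            K k ∈ LQR.stabilizing A B ∧
            LQR.cost A B Q R S (K k) - LQR.cost A B Q R S (LQR.optimalGain A B Q R) ≤
              (((1 - σ / μ) ^ k : ℝ) : EReal) *
                (LQR.cost A B Q R S K₀ - LQR.cost A B Q R S (LQR.optimalGain A B Q R)) ∧
            LQR.specNorm (K k - LQR.optimalGain A B Q R) ^ 2 ≤
              b * (1 - σ / μ) ^ k * LQR.specNorm (K₀ - LQR.optimalGain A B Q R) ^ 2 ∧
            LQR.frobNorm (K k - LQR.optimalGain A B Q R) ^ 2 ≤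
              b * (1 - σ / μ) ^ k * LQR.frobNorm (K₀ - LQR.optimalGain A B Q R) ^ 2 := by
  obtain ⟨μ, σm, p, q, hσm0, hσmμ, hp, hq, hcon⟩ :=
    LQR.exists_contraction_constants hQ hR hS A B (abs_nonneg a)
  -- `q / p` suffices for the Frobenius norm; the factor `n + 1` pays for the passage to the
  -- spectral norm of the initial error.
  refine ⟨μ, σm, (n + 1) * (q / p), hσm0, hσmμ, by positivity, ?_⟩
  intro K₀ hK₀ hcost θ _ hθ σ hσ hσσm N K hK0 hrun k hk
  subst hK0
  have hμ : 0 < μ := hσm0.trans hσmμ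
  have hγ : 0 ≤ 1 - σ / μ := by
    rw [sub_nonneg, div_le_one hμ]
    linarith
  have hL := (LQR.optimalGain_spec hQ hR hK₀).1
  have ha : LQR.lqrValue A B Q R S (K 0) ≤ |a| := by
    rw [LQR.cost_eq_lqrValue Q R S hK₀, EReal.coe_eq_coe_iff] at hcost
    exact hcost.le.trans (le_abs_self a)
  have hind : ∀ j ≤ N, K j ∈ LQR.stabilizing A B ∧ LQR.lqrValue A B Q R S (K j) ≤ |a| ∧
      LQR.lqrValue A B Q R S (K j) - LQR.lqrValue A B Q R S (LQR.optimalGain A B Q R) ≤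
        (1 - σ / μ) ^ j * (LQR.lqrValue A B Q R S (K 0) -
          LQR.lqrValue A B Q R S (LQR.optimalGain A B Q R)) := by
    intro j
    induction j with
    | zero => exact fun _ => ⟨hK₀, ha, by simp⟩
    | succ j ih =>
      intro hj
      obtain ⟨hKj, hKja, hdec⟩ := ih (by omega)
      obtain ⟨G, hG, hstep⟩ := hrun j (by omega)
      obtain ⟨hs, hsa, hsdec⟩ := (hcon (K j) hKj hKja).2.2 θ hθ σ hσ hσσm G hG
      rw [hstep]
      refine ⟨hs, hsa, hsdec.trans ?_⟩
      rw [pow_succ', mul_assoc]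
      gcongr
  obtain ⟨hKk, hKka, hdec⟩ := hind k hk
  have hfrob : LQR.frobNorm (K k - LQR.optimalGain A B Q R) ^ 2 ≤
      q / p * (1 - σ / μ) ^ k * LQR.frobNorm (K 0 - LQR.optimalGain A B Q R) ^ 2 := by
    have h1 : p * LQR.frobNorm (K k - LQR.optimalGain A B Q R) ^ 2 ≤ _ := (hcon _ hKk hKka).1
    have h2 : _ ≤ q * LQR.frobNorm (K 0 - LQR.optimalGain A B Q R) ^ 2 := (hcon _ hK₀ ha).2.1
    have h3 := h1.trans (hdec.trans (mul_le_mul_of_nonneg_left h2 (pow_nonneg hγ k)))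
    refine le_of_mul_le_mul_left (h3.trans_eq ?_) hp
    field_simp
  have hpow := pow_nonneg hγ k
  have hspec0 : 0 ≤ LQR.specNorm (K k - LQR.optimalGain A B Q R) := norm_nonneg _
  have hn : (0 : ℝ) ≤ n := Nat.cast_nonneg n
  have hqp : 0 ≤ q / p * (1 - σ / μ) ^ k := by positivity
  refine ⟨hKk, ?_, ?_, ?_⟩
  · rw [LQR.cost_eq_lqrValue Q R S hKk, LQR.cost_eq_lqrValue Q R S hL,
      LQR.cost_eq_lqrValue Q R S hK₀]
    exact_mod_cast hdec
  · calc LQR.specNorm (K k - LQR.optimalGain A B Q R) ^ 2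
        ≤ LQR.frobNorm (K k - LQR.optimalGain A B Q R) ^ 2 :=
          pow_le_pow_left₀ hspec0 (LQR.specNorm_le_frobNorm _) 2
      _ ≤ q / p * (1 - σ / μ) ^ k * (n * LQR.specNorm (K 0 - LQR.optimalGain A B Q R) ^ 2) :=
          hfrob.trans (mul_le_mul_of_nonneg_left (LQR.frobNorm_sq_le_specNorm_sq _) hqp)
      _ ≤ q / p * (1 - σ / μ) ^ k *
            ((n + 1) * LQR.specNorm (K 0 - LQR.optimalGain A B Q R) ^ 2) := by
          gcongr
          linarith
      _ = _ := by ring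
  · calc _ ≤ _ := hfrob
      _ ≤ q / p * (1 - σ / μ) ^ k *
            ((n + 1) * LQR.frobNorm (K 0 - LQR.optimalGain A B Q R) ^ 2) := by
          gcongr
          exact le_mul_of_one_le_left (sq_nonneg _) (by linarith)
      _ = _ := by ring
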